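/- Fix $n\ge 2$. For a matrix $A\in M_n(\mathbb Z)$ with $\det A\ne 0$ and characteristic polynomial $h_A\in\mathbb Z[x]$ put $$G_A=\{A^{-k}x \mid x\in\mathbb Z^n,\ k\in\mathbb Z\}\subseteq\mathbb Q^n,\qquad \mathcal R(A)=\mathbb Z[1/\det A]\subseteq\mathbb Q .$$ For a prime $p$ let $t_p(A)$ be the multiplicity of $0$ as a root of $h_A$ modulo $p$, let $\mathcal P'(A)$ be the set of primes $p$ dividing $\det A$ with $h_A\not\equiv x^n \pmod p$, and let $\overline G_{A,p}=G_A\otimes_{\mathbb Z}\mathbb Z_p\subseteq\mathbb Q_p^n$. A family $(\alpha_{pij}(A))$ of elements of $\mathbb Z_p$, indexed by $p\in\mathcal P'(A)$ and $1\le i\le t_p(A)<j\le n$, is called the characteristic of $G_A$ relative to the standard basis $e_1,\dots,e_n$ if for every $p\in\mathcal P'(A)$, with $t=t_p(A)$, $$\overline G_{A,p}=\operatorname{Span}_{\mathbb Q_p}(x_{p1},\dots,x_{pt})\oplus\operatorname{Span}_{\mathbb Z_p}(e_{t+1},\dots,e_n),\qquad x_{pi}=e_i+\sum_{j=t+1}^n\alpha_{pij}(A)\,e_j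 .$$ Let $A,B\in M_n(\mathbb Z)$ have non-zero determinants and irreducible characteristic polynomials, and assume that $G_A$ and $G_B$ have characteristics $(\alpha_{pij}(A))$ and $(\alpha_{pij}(B))$ relative to the standard basis. For $p\in\mathcal P'(B)$, a matrix $T=(\gamma_{kj})\in GL_n(\mathbb Q)$ is said to satisfy the condition $(A,B,p)$ if, with $t=t_p(B)$, $$\gamma_{kj}-\sum_{i=1}^{t}\gamma_{ij}\,\alpha_{pik}(B)\in\mathbb Z_p\qquad\text{for all }k,j\in\{t+1,\dots,n\};$$ the condition $(B,A,p)$, for $p\in\mathcal P'(A)$, is defined in the same way with $A$ and $B$ exchanged. Assume that there is a prime $p$ with $\gcd(t_p(A),n)=1$, and let $K$ be a number field, with ring of integers $\mathcal O_K$, that contains all eigenvalues of $A$ and of $B$. Let $T\in GL_n(\mathbb Q)$. Then $T$ is an isomorphism from $G_A$ to $G_B$, i.e. $T(G_A)=G_B$, if and only if there are eigenvalues $\lambda,\mu\in\mathcal O_K$ of $A$, $B$ with eigenvectors $u,v\in K^n$ of $A$, $B$, respectively ($Au=\lambda u$, $Bv=\mu v$, $u\ne0\ne v$), such that $\lambda$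 and $\mu$ have the same prime ideal divisors in $\mathcal O_K$, $T\in GL_n(\mathcal R(A))$, $T(u)=v$, $T$ satisfies the condition $(A,B,p)$ for all $p\in\mathcal P'(B)$, and $T^{-1}$ satisfies the condition $(B,A,p)$ for all $p\in\mathcal P'(A)$. -/

import Mathlib

open scoped Matrix NumberField

noncomputable section

namespace Solenoid

/-- The integer matrix `A`, regarded as a matrix over a commutative ring `K`. -/
abbrev baseChange (K : Type*) [CommRing K] {n : ℕ} (A : Matrix (Fin n) (Fin n) ℤ) :
    Matrix (Fin n) (Fin n) K :=
  A.map (Int.castRingHom K)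

/-- A power of `A` with non-negative exponent maps `ℤⁿ` to itself. -/
theorem baseChange_pow_mulVec {n : ℕ} (A : Matrix (Fin n) (Fin n) ℤ) (m : ℕ) (x : Fin n → ℤ) :
    baseChange ℚ A ^ m *ᵥ (fun i => (x i : ℚ)) = fun i => (((A ^ m *ᵥ x) i : ℤ) : ℚ) := by
  have h : baseChange ℚ A ^ m = (A ^ m).map (Int.castRingHom ℚ) :=
    (Matrix.map_pow A (Int.castRingHom ℚ) m).symm
  rw [h]
  ext i
  exact (RingHom.map_mulVec (Int.castRingHom ℚ) (A ^ m) x i).symm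

/-- If `A` is non-singular, an element `A⁻ᵏ x` with `x ∈ ℤⁿ` can be rewritten as `A⁻ᵐ y` with
`y ∈ ℤⁿ`, for every `m ≥ k`. -/
theorem exists_eq_zpow_neg_mulVec {n : ℕ} (A : Matrix (Fin n) (Fin n) ℤ) (hA : A.det ≠ 0)
    (k : ℤ) (m : ℕ) (hkm : k ≤ m) (x : Fin n → ℤ) :
    ∃ y : Fin n → ℤ, baseChange ℚ A ^ (-k) *ᵥ (fun i => (x i : ℚ)) =
      baseChange ℚ A ^ (-(m : ℤ)) *ᵥ (fun i => (y i : ℚ)) := by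
  have hu : IsUnit (baseChange ℚ A).det := by
    have h : (baseChange ℚ A).det = ((A.det : ℤ) : ℚ) :=
      (RingHom.map_det (Int.castRingHom ℚ) A).symm
    rw [h]
    exact isUnit_iff_ne_zero.mpr (by exact_mod_cast hA)
  obtain ⟨d, hd⟩ := Int.eq_ofNat_of_zero_le (sub_nonneg.mpr hkm)
  refine ⟨A ^ d *ᵥ x, ?_⟩
  rw [← baseChange_pow_mulVec, Matrix.mulVec_mulVec, ← zpow_natCast, ← Matrix.zpow_add hu, ← hd]
  have he : -k = -(m : ℤ) + (m - k) := by ring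
  rw [← he]

/-- The group `G_A = {A⁻ᵏ x | x ∈ ℤⁿ, k ∈ ℤ} ⊆ ℚⁿ`. -/
def G {n : ℕ} (A : Matrix (Fin n) (Fin n) ℤ) : AddSubgroup (Fin n → ℚ) where
  carrier := {y | ∃ (k : ℤ) (x : Fin n → ℤ), y = baseChange ℚ A ^ (-k) *ᵥ (fun i => (x i : ℚ))}
  zero_mem' := ⟨0, 0, by ext i; simp⟩
  neg_mem' := by
    rintro _ ⟨k, x, rfl⟩
    refine ⟨k, -x, ?_⟩
    rw [← Matrix.mulVec_neg]
    congr 1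
  add_mem' := by
    rintro _ _ ⟨k, x, rfl⟩ ⟨l, y, rfl⟩
    by_cases hA : A.det = 0
    · have key : ∀ (k : ℤ) (x : Fin n → ℤ), ∃ z : Fin n → ℤ,
          baseChange ℚ A ^ (-k) *ᵥ (fun i => (x i : ℚ)) = fun i => (z i : ℚ) := by
        intro k x
        obtain ⟨m, rfl | rfl⟩ := Int.eq_nat_or_neg k
        · rcases Nat.eq_zero_or_pos m with rfl | hm
          · exact ⟨x, by simp⟩
          · refine ⟨0, ?_⟩
            have h : ((baseChange ℚ A) ^ m).det = 0 := by
              have h' : (baseChange ℚ A).det = ((A.det : ℤ) : ℚ) :=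
                (RingHom.map_det (Int.castRingHom ℚ) A).symm
              rw [Matrix.det_pow, h', hA, Int.cast_zero, zero_pow hm.ne']
            rw [Matrix.zpow_neg_natCast, Matrix.nonsing_inv_apply_not_isUnit _ (by simp [h]),
              Matrix.zero_mulVec]
            ext i
            simp
        · refine ⟨A ^ m *ᵥ x, ?_⟩
          rw [neg_neg, zpow_natCast, baseChange_pow_mulVec]
      obtain ⟨z, hz⟩ := key k x
      obtain ⟨w, hw⟩ := key l y
      refine ⟨0, z + w, ?_⟩
      rw [hz, hw]
      ext i
      simp
    · obtain ⟨z, hz⟩ := exists_eq_zpow_neg_mulVec A hA k (k.natAbs + l.natAbs) (by omega) x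
      obtain ⟨w, hw⟩ := exists_eq_zpow_neg_mulVec A hA l (k.natAbs + l.natAbs) (by omega) y
      refine ⟨(k.natAbs + l.natAbs : ℕ), z + w, ?_⟩
      rw [hz, hw, ← Matrix.mulVec_add]
      congr 1
      ext i
      simp

/-- The ring `ℛ(A) = ℤ[1/N]`, `N = det A`, as a subring of `ℚ`. -/
def R {n : ℕ} (A : Matrix (Fin n) (Fin n) ℤ) : Subalgebra ℤ ℚ :=
  Algebra.adjoin ℤ {((A.det : ℤ) : ℚ)⁻¹}

/-- `t_p(A)`: the multiplicity of zero as a root of the reduction modulo `p` of the characteristic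
polynomial of `A`. -/
def t {n : ℕ} (p : ℕ) (A : Matrix (Fin n) (Fin n) ℤ) : ℕ :=
  (A.charpoly.map (Int.castRingHom (ZMod p))).rootMultiplicity 0

/-- `𝒫'(A)`: the primes `p` dividing `det A` for which the characteristic polynomial of `A` is not
congruent to `xⁿ` modulo `p`. -/
def P' {n : ℕ} (A : Matrix (Fin n) (Fin n) ℤ) : Set ℕ :=
  {p | p.Prime ∧ (p : ℤ) ∣ A.det ∧
    A.charpoly.map (Int.castRingHom (ZMod p)) ≠ (Polynomial.X : Polynomial (ZMod p)) ^ n}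

/-- `Ḡ_{A,p} = G_A ⊗ ℤ_p`, realised inside `ℚ_pⁿ` as the `ℤ_p`-span of the image of `G_A`. -/
def Gbar {n : ℕ} (p : ℕ) [Fact p.Prime] (A : Matrix (Fin n) (Fin n) ℤ) :
    Submodule ℤ_[p] (Fin n → ℚ_[p]) :=
  Submodule.span ℤ_[p] ((fun (y : Fin n → ℚ) (i : Fin n) => (y i : ℚ_[p])) '' (G A : Set _))

/-- The vector `x_i = e_i + ∑_{j > t} α_{ij} e_j` of `ℚ_pⁿ`. The index `j > t` of the `1`-based
numbering `1, …, n` reads `t ≤ j` in the `0`-based numbering of `Fin n`. -/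
def xVec {n : ℕ} (p : ℕ) [Fact p.Prime] (t : ℕ) (α : Fin n → Fin n → ℤ_[p]) (i : Fin n) :
    Fin n → ℚ_[p] :=
  Pi.single i 1 +
    ∑ j ∈ Finset.univ.filter (fun j : Fin n => t ≤ (j : ℕ)), (α i j : ℚ_[p]) • Pi.single j 1

/-- The family `α` of `p`-adic integers is the characteristic of `G_A` relative to the standard
basis `e_1, …, e_n`: for every `p ∈ 𝒫'(A)`, with `t = t_p(A)`,
`Ḡ_{A,p} = Span_{ℚ_p}(x_{p1}, …, x_{pt}) ⊕ Span_{ℤ_p}(e_{t+1}, …, e_n)`, where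
`x_{pi} = e_i + ∑_{j > t} α_{pij} e_j`.
Only the entries `α_{pij}` with `p ∈ 𝒫'(A)`, `i ≤ t < j` (in `1`-based numbering) are relevant.
The sum is direct because `x_{p1}, …, x_{pt}, e_{t+1}, …, e_n` is a basis of `ℚ_pⁿ`. -/
def IsCharacteristic {n : ℕ} (A : Matrix (Fin n) (Fin n) ℤ)
    (α : ∀ (p : ℕ) [Fact p.Prime], Fin n → Fin n → ℤ_[p]) : Prop :=
  ∀ (p : ℕ) [Fact p.Prime], p ∈ P' A →
    Gbar p A =
      (Submodule.span ℚ_[p]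
        {w | ∃ i : Fin n, (i : ℕ) < t p A ∧ w = xVec p (t p A) (α p) i}).restrictScalars ℤ_[p] ⊔
      Submodule.span ℤ_[p]
        {w | ∃ j : Fin n, t p A ≤ (j : ℕ) ∧ w = Pi.single j 1}

/-- The condition `(A, B, p)` on a rational matrix `T = (γ_{kj})`, where `β` is the characteristic
of `G_B`: for all `k, j ∈ {t+1, …, n}`, `t = t_p(B)`, one has
`γ_{kj} - ∑_{i=1}^{t} γ_{ij} β_{pik} ∈ ℤ_p`. The condition involves only `B` and `p`. -/
def SatisfiesCondition {n : ℕ} (B : Matrix (Fin n) (Fin n) ℤ) (p : ℕ) [Fact p.Prime]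
    (β : Fin n → Fin n → ℤ_[p]) (T : Matrix (Fin n) (Fin n) ℚ) : Prop :=
  ∀ k j : Fin n, t p B ≤ (k : ℕ) → t p B ≤ (j : ℕ) →
    (T k j : ℚ_[p]) - ∑ i ∈ Finset.univ.filter (fun i : Fin n => (i : ℕ) < t p B),
        (T i j : ℚ_[p]) * (β i k : ℚ_[p])
      ∈ PadicInt.subring p

/-- `T ∈ GL_n(S)` for an invertible rational matrix `T` and a subring `S` of `ℚ`: the entries of
both `T` and `T⁻¹` lie in `S`. -/
def MemGL {n : ℕ} (S : Subalgebra ℤ ℚ) (T : GL (Fin n) ℚ) : Prop :=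
  ∀ i j : Fin n, (T : Matrix (Fin n) (Fin n) ℚ) i j ∈ S ∧
    ((T⁻¹ : GL (Fin n) ℚ) : Matrix (Fin n) (Fin n) ℚ) i j ∈ S

/-- `u ∈ Kⁿ` is an eigenvector (in particular, non-zero) of `A` with eigenvalue `a ∈ K`. -/
def IsEigenvector {n : ℕ} (K : Type*) [Field K] (A : Matrix (Fin n) (Fin n) ℤ) (a : K)
    (u : Fin n → K) : Prop :=
  Module.End.HasEigenvector (Matrix.toLin' (baseChange K A)) a u

/-- `a, b ∈ 𝒪_K` have the same prime ideal divisors in `𝒪_K`. -/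
def SamePrimeDivisors {K : Type*} [Field K] [NumberField K] (a b : 𝓞 K) : Prop :=
  ∀ 𝔭 : Ideal (𝓞 K), 𝔭.IsPrime → 𝔭 ≠ ⊥ → (𝔭 ∣ Ideal.span {a} ↔ 𝔭 ∣ Ideal.span {b})

end Solenoid

end

/-! Everything is read off at each prime `p` from two objects in `ℚ_pⁿ`: the local group `Gbar p A`,
consisting of the `y` for which some `A ^ k y` is integral, and its largest `ℚ_p`-subspace
`contracted p A`, the vectors with `A ^ k y → 0`. The characteristic shows that this subspace has
dimension `t p A` (`finrank_contracted`).

Suppose `T` is an isomorphism. Then `A` and `C = T⁻¹BT` both preserve `contracted p A`. The algebra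
they generate acts irreducibly on `ℚⁿ`, so by density it contains `m × m` matrix units, where `m` is
the dimension of `ℚⁿ` over the commutant. These cut both `ℚⁿ` and `contracted p A` into `m` pieces
of equal dimension, so `m` divides `gcd(t, n) = 1`. The commutant is therefore transitive on nonzero
vectors, which forces `C` to commute with `A` (`commute_of_coprime_finrank`). Hence `C = f(A)`, and
`T` carries an eigenvector for `a` to one for `b = f(a)`. Pairing `G_A` and `G_B` with matching left
eigenvectors and applying Krull's intersection theorem shows that `a` and `b` have the same prime
divisors (`mem_prime_of_mem_prime`).

Conversely, equal prime divisors give `b ^ m = a c` with `c` integral. The matrix `M = T⁻¹B ^ m T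
A⁻¹` has eigenvalue `c` on `u`; because the entries of `u` are independent over `ℚ`, `M` commutes
with `A` and is integral, so its powers are `p`-adically bounded. From `B ^ (mk) T = T M ^ k A ^ k`
it follows that `T` maps contracted vectors to contracted vectors. The conditions at `p` control the
remaining basis vectors `e_j`, membership in `GL_n(ℛ(A))` controls the primes not dividing the
determinant, and the local inclusions assemble to `T G_A ⊆ G_B` (`mem_G_of_forall_mem_Gbar`). The
inverse is treated symmetrically. -/

open scoped Matrix NumberField

noncomputable section

namespace Solenoid

/-! ### Matrices with irreducible characteristic polynomial -/

section Cyclic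

variable {F : Type*} [Field F] {n : ℕ}

/-- If the characteristic polynomial is irreducible, every non-zero vector is cyclic. -/
theorem exists_aeval_mulVec_eq {A : Matrix (Fin n) (Fin n) F} (h : Irreducible A.charpoly)
    {w : Fin n → F} (hw : w ≠ 0) (x : Fin n → F) :
    ∃ f : Polynomial F, Polynomial.aeval A f *ᵥ w = x := by
  let φ : Polynomial F →ₗ[F] (Fin n → F) :=
    (Matrix.mulVecBilin F F).flip w ∘ₗ (Polynomial.aeval A).toLinearMap
  have hφ : ∀ f, φ f = Polynomial.aeval A f *ᵥ w := fun f => rfl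
  let ψ : Polynomial.degreeLT F n →ₗ[F] (Fin n → F) := φ.domRestrict _
  have hinj : Function.Injective ψ := by
    rw [injective_iff_map_eq_zero]
    rintro ⟨f, hf⟩ h0
    by_contra hne
    have hf0 : f ≠ 0 := fun h => hne (by simp [h])
    replace h0 : Polynomial.aeval A f *ᵥ w = 0 := h0
    have hnd : ¬ A.charpoly ∣ f := by
      intro hd
      have h1 := Polynomial.degree_le_of_dvd hd hf0
      rw [Matrix.charpoly_degree_eq_dim, Fintype.card_fin] at h1
      exact absurd (Polynomial.mem_degreeLT.mp hf) (not_lt.mpr h1)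
    -- Bézout evaluated at `A` and applied to `w`: the characteristic polynomial vanishes by
    -- Cayley–Hamilton and `f(A) w = 0`, so `w = 0`.
    obtain ⟨a, b, hab⟩ := (h.coprime_iff_not_dvd).mpr hnd
    apply hw
    have h2 := congrArg (fun g => Polynomial.aeval A g *ᵥ w) hab
    simpa [Matrix.aeval_self_charpoly, ← Matrix.mulVec_mulVec, h0] using h2.symm
  have hsurj : Function.Surjective ψ := by
    refine (LinearMap.injective_iff_surjective_of_finrank_eq_finrank ?_).mp hinj
    exact (Polynomial.degreeLTEquiv F n).finrank_eq
  obtain ⟨f, hf⟩ := hsurj x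
  exact ⟨f, hf⟩

/-- Choose `f` with `f(A) w = C w` at one cyclic vector `w`. Both matrices commute with polynomials
in `A`, so they agree on all of `F[A] w`. -/
theorem exists_eq_aeval_of_commute {A C : Matrix (Fin n) (Fin n) F}
    (h : Irreducible A.charpoly) (hn : 0 < n) (hc : Commute A C) :
    ∃ f : Polynomial F, C = Polynomial.aeval A f := by
  have : Nonempty (Fin n) := ⟨⟨0, hn⟩⟩
  obtain ⟨w, hw⟩ := exists_ne (0 : Fin n → F)
  obtain ⟨f, hf⟩ := exists_aeval_mulVec_eq h hw (C *ᵥ w)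
  refine ⟨f, Matrix.mulVec_injective (funext fun x => ?_)⟩
  obtain ⟨g, rfl⟩ := exists_aeval_mulVec_eq h hw x
  have hg : C * Polynomial.aeval A g = Polynomial.aeval A g * C :=
    Algebra.commute_of_mem_adjoin_singleton_of_commute
      (Polynomial.aeval_mem_adjoin_singleton F A) hc.symm
  rw [Matrix.mulVec_mulVec, hg, ← Matrix.mulVec_mulVec, ← hf, Matrix.mulVec_mulVec,
    Matrix.mulVec_mulVec, ← map_mul, ← map_mul, mul_comm]

theorem transpose_aeval (A : Matrix (Fin n) (Fin n) F) (f : Polynomial F) :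
    (Polynomial.aeval A f)ᵀ = Polynomial.aeval Aᵀ f := by
  induction f using Polynomial.induction_on' with
  | add p q hp hq => simp [hp, hq]
  | monomial k c =>
    rw [Polynomial.aeval_monomial, Polynomial.aeval_monomial, ← Algebra.smul_def,
      ← Algebra.smul_def, Matrix.transpose_smul, Matrix.transpose_pow]

variable {K : Type*} [Field K] [Algebra F K]

theorem aeval_map_mulVec_of_eigenvector {A : Matrix (Fin n) (Fin n) F} {a : K} {u : Fin n → K}
    (hu : A.map (algebraMap F K) *ᵥ u = a • u) (f : Polynomial F) :
    (Polynomial.aeval A f).map (algebraMap F K) *ᵥ u = Polynomial.aeval a f • u := by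
  induction f using Polynomial.induction_on' with
  | add p q hp hq => 
    rw [map_add, map_add, Matrix.map_add _ (map_add _), Matrix.add_mulVec, hp, hq, add_smul]
  | monomial k c =>
    have hk : (A ^ k).map (algebraMap F K) *ᵥ u = a ^ k • u := by
      induction k with
      | zero => simp
      | succ k ih =>
        rw [pow_succ, Matrix.map_mul, ← Matrix.mulVec_mulVec, hu, Matrix.mulVec_smul, ih,
          smul_smul, pow_succ']
    rw [Polynomial.aeval_monomial, Polynomial.aeval_monomial, ← Algebra.smul_def,
      ← Algebra.smul_def, Matrix.map_smul' _ _ _ (map_mul _), Matrix.smul_mulVec, hk,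
      smul_assoc, algebraMap_smul]

/-- The entries of an eigenvector of a matrix over `F` with irreducible characteristic polynomial
are linearly independent over `F`. -/
theorem eq_zero_of_map_mulVec_eq_zero {A X : Matrix (Fin n) (Fin n) F}
    (h : Irreducible A.charpoly) {a : K} {u : Fin n → K} (hu0 : u ≠ 0)
    (hu : A.map (algebraMap F K) *ᵥ u = a • u) (hX : X.map (algebraMap F K) *ᵥ u = 0) :
    X = 0 := by
  by_contra hX0
  obtain ⟨i, hi⟩ : ∃ i, X i ≠ 0 := by
    by_contra! hh
    exact hX0 (funext hh)
  have hT : Irreducible Aᵀ.charpoly := by rwa [Matrix.charpoly_transpose]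
  apply hu0
  funext j
  -- A nonzero row of `X` is cyclic for `Aᵀ`, so some `X f(A)` has `i`-th row `e_j`. As `X f(A)`
  -- still kills `u`, the entry `u j` vanishes.
  obtain ⟨f, hf⟩ := exists_aeval_mulVec_eq hT hi (Pi.single j 1)
  have hf' : X i ᵥ* Polynomial.aeval A f = Pi.single j 1 := by
    rw [← hf, ← Matrix.mulVec_transpose, transpose_aeval]
  have h1 : (X * Polynomial.aeval A f).map (algebraMap F K) *ᵥ u = 0 := by
    rw [Matrix.map_mul, ← Matrix.mulVec_mulVec, aeval_map_mulVec_of_eigenvector hu,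
      Matrix.mulVec_smul, hX, smul_zero]
  have h2 := congrFun h1 i
  have h3 : ((X * Polynomial.aeval A f).map (algebraMap F K)) i = Pi.single j 1 := by
    funext k
    have := congrFun hf' k
    rw [Matrix.map_apply, Matrix.mul_apply_eq_vecMul, this, Pi.single_apply, Pi.single_apply]
    split_ifs <;> simp
  rw [Matrix.mulVec, h3] at h2
  simpa using h2

end Cyclic

/-! ### Matrix units and the coprimality argument -/

section Density

/-- The idempotents `e i i` all have the same trace, since `e i o * e o i` and `e o i * e i o` do.
In characteristic zero the trace of an idempotent is its rank, so the dimension is `m` times the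
rank of `e o o`. -/
theorem dvd_finrank_of_matrixUnits {k D : Type*} [Field k] [CharZero k] [AddCommGroup D]
    [Module k D] [FiniteDimensional k D] {m : ℕ} (e : Fin m → Fin m → Module.End k D)
    (h1 : ∑ i, e i i = 1) (h2 : ∀ i j, e i j * e j i = e i i) : m ∣ Module.finrank k D := by
  rcases Nat.eq_zero_or_pos m with rfl | hm
  · have h0 : (0 : Module.End k D) = 1 := by simpa using h1
    have : Subsingleton D := ⟨fun x y => by
      rw [← Module.End.one_apply (R := k) x, ← Module.End.one_apply (R := k) y, ← h0]; simp⟩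
    simp [Module.finrank_zero_of_subsingleton]
  · let o : Fin m := ⟨0, hm⟩
    have hidem : IsIdempotentElem (e o o) := h2 o o
    have htr : ∀ i, LinearMap.trace k D (e i i) = LinearMap.trace k D (e o o) := fun i => by
      rw [← h2 i o, LinearMap.trace_mul_comm, h2 o i]
    have hp := (LinearMap.IsIdempotentElem.isProj_range _ hidem).trace
    have h3 := congrArg (LinearMap.trace k D) h1
    rw [map_sum, Finset.sum_congr rfl (fun i _ => htr i), hp, LinearMap.trace_one] at h3
    refine ⟨Module.finrank k (LinearMap.range (e o o)), ?_⟩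
    simp only [Finset.sum_const, Finset.card_univ, Fintype.card_fin, nsmul_eq_mul] at h3
    exact_mod_cast h3.symm

/-- Matrix units in a ring acting on a simple module, by the density theorem. -/
theorem exists_matrixUnits_of_isSimpleModule (R M : Type*) [Ring R] [AddCommGroup M] [Module R M]
    [IsSimpleModule R M] [Module.Finite (Module.End R M) M] :
    ∃ (m : ℕ) (r : Fin m → Fin m → R), (∀ v : M, ∑ i, r i i • v = v) ∧
      (∀ i j (v : M), r i j • r j i • v = r i i • v) ∧
      (m = 1 → ∀ x : M, x ≠ 0 → ∀ y, ∃ c : Module.End R M, c x = y) := by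
  classical
  -- By Schur the commutant is a division ring; `E i j` are the elementary matrices of a basis over
  -- it, and density realises them by elements of `R`.
  let b := Module.finBasis (Module.End R M) M
  let E : Fin _ → Fin _ → Module.End (Module.End R M) M := fun i j =>
    (LinearMap.toSpanSingleton (Module.End R M) _ (b i)) ∘ₗ (b.coord j)
  have hE : ∀ i j v, E i j v = b.repr v j • b i := fun i j v => rfl
  have hsurj := Module.Finite.toModuleEnd_moduleEnd_surjective (R := R) (M := M)
  choose r hr using fun i j => hsurj (E i j)
  have hr' : ∀ i j v, r i j • v = E i j v := fun i j v => by
    rw [← hr]; rfl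
  refine ⟨_, r, fun v => ?_, fun i j v => ?_, fun hm x hx y => ?_⟩
  · simp only [hr', hE]
    exact b.sum_repr v
  · simp only [hr', hE, map_smul, b.repr_self]
    simp
  · exact exists_smul_eq_of_finrank_eq_one hm hx y

/-- Matrix units in the algebra generated by `A` and `C` when `A` has irreducible
characteristic polynomial, by the density theorem; if only the trivial one exists, then `A` and `C`
commute. -/
theorem exists_matrixUnits {n : ℕ} {A C : Matrix (Fin n) (Fin n) ℚ}
    (h : Irreducible A.charpoly) (hn : 0 < n) :
    ∃ (m : ℕ) (e : Fin m → Fin m → Module.End ℚ (Fin n → ℚ)),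
      (∀ i j, e i j ∈ Algebra.adjoin ℚ {Matrix.toLin' A, Matrix.toLin' C}) ∧
      ∑ i, e i i = 1 ∧ (∀ i j, e i j * e j i = e i i) ∧ (m = 1 → Commute A C) := by
  have : Nonempty (Fin n) := ⟨⟨0, hn⟩⟩
  obtain ⟨w, hw⟩ := exists_ne (0 : Fin n → ℚ)
  let R := Algebra.adjoin ℚ {Matrix.toLin' A, Matrix.toLin' C}
  have hAR : Matrix.toLin' A ∈ R := Algebra.subset_adjoin (by simp)
  have hCR : Matrix.toLin' C ∈ R := Algebra.subset_adjoin (by simp)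
  have hfR : ∀ f : Polynomial ℚ, Matrix.toLin' (Polynomial.aeval A f) ∈ R := by
    intro f
    have := Polynomial.aeval_algHom_apply (Matrix.toLinAlgEquiv' (R := ℚ) (n := Fin n)) A f
    have h2 : Matrix.toLin' (Polynomial.aeval A f) = Polynomial.aeval (Matrix.toLin' A) f :=
      this.symm
    rw [h2]
    exact (Algebra.adjoin_mono (by simp)) (Polynomial.aeval_mem_adjoin_singleton ℚ _)
  have hsimple : IsSimpleModule R (Fin n → ℚ) := by
    rw [isSimpleModule_iff_toSpanSingleton_surjective]
    refine ⟨inferInstance, fun x hx y => ?_⟩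
    obtain ⟨f, hf⟩ := exists_aeval_mulVec_eq h hx y
    exact ⟨⟨_, hfR f⟩, hf⟩
  have : Module.Finite (Module.End R (Fin n → ℚ)) (Fin n → ℚ) :=
    Module.Finite.of_restrictScalars_finite ℚ _ _
  obtain ⟨m, r, h1, h2, h3⟩ := exists_matrixUnits_of_isSimpleModule R (Fin n → ℚ)
  refine ⟨m, fun i j => r i j, fun i j => (r i j).2, ?_, ?_, ?_⟩
  · refine LinearMap.ext fun v => ?_
    rw [LinearMap.sum_apply]
    exact h1 v
  · intro i j
    exact LinearMap.ext fun v => h2 i j v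
  · intro hm
    -- For `m = 1` some `c` in the commutant agrees with `A` at `w`, hence on `ℚ[A] w`, which is
    -- everything. Thus `A` itself lies in the commutant and commutes with `C`.
    obtain ⟨c, hc⟩ := h3 hm w hw (A *ᵥ w)
    have hcA : ∀ x, c x = A *ᵥ x := by
      intro x
      obtain ⟨f, rfl⟩ := exists_aeval_mulVec_eq h hw x
      have h4 := c.map_smul ⟨_, hfR f⟩ w
      have h5 : c (Polynomial.aeval A f *ᵥ w) = Polynomial.aeval A f *ᵥ c w := h4
      have h6 : Commute (Polynomial.aeval A f) A :=
        (Algebra.commute_of_mem_adjoin_singleton_of_commute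
          (Polynomial.aeval_mem_adjoin_singleton ℚ A) (Commute.refl A)).symm
      rw [h5, hc, Matrix.mulVec_mulVec, Matrix.mulVec_mulVec, h6.eq]
    refine Matrix.mulVec_injective (funext fun x => ?_)
    have h4 : c (C *ᵥ x) = C *ᵥ c x := c.map_smul ⟨_, hCR⟩ x
    rw [← Matrix.mulVec_mulVec, ← Matrix.mulVec_mulVec, ← hcA, ← hcA, h4]

/-- If `A` has irreducible characteristic polynomial and `A`, `C` stabilise a subspace over an
extension field whose dimension is prime to the size of the matrices, then they commute. -/
theorem commute_of_coprime_finrank {n : ℕ} {A C : Matrix (Fin n) (Fin n) ℚ}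
    (h : Irreducible A.charpoly) (hn : 0 < n) {k : Type*} [Field k] [Algebra ℚ k]
    (D : Submodule k (Fin n → k)) (hA : ∀ x ∈ D, A.map (algebraMap ℚ k) *ᵥ x ∈ D)
    (hC : ∀ x ∈ D, C.map (algebraMap ℚ k) *ᵥ x ∈ D)
    (hcop : Nat.Coprime (Module.finrank k D) n) : Commute A C := by
  have : CharZero k := algebraRat.charZero k
  obtain ⟨m, e, he, h1, h2, h3⟩ := exists_matrixUnits (C := C) h hn
  have hmn : m ∣ n := by simpa using dvd_finrank_of_matrixUnits e h1 h2
  let φ : Module.End ℚ (Fin n → ℚ) →ₐ[ℚ] Module.End k (Fin n → k) :=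
    ((Matrix.toLinAlgEquiv' (R := k) (n := Fin n)).toAlgHom.restrictScalars ℚ).comp
      ((AlgHom.mapMatrix (Algebra.ofId ℚ k)).comp LinearMap.toMatrixAlgEquiv'.toAlgHom)
  have hφ : ∀ (M : Matrix (Fin n) (Fin n) ℚ) x,
      φ (Matrix.toLin' M) x = M.map (algebraMap ℚ k) *ᵥ x := by
    intro M x
    have : LinearMap.toMatrixAlgEquiv' (Matrix.toLin' M) = M := LinearMap.toMatrix'_toLin' M
    change (Matrix.toLin' ((LinearMap.toMatrixAlgEquiv' (Matrix.toLin' M)).map _)) x = _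
    rw [this]
    rfl
  have hD : ∀ r ∈ Algebra.adjoin ℚ {Matrix.toLin' A, Matrix.toLin' C}, ∀ x ∈ D, φ r x ∈ D := by
    intro r hr
    induction hr using Algebra.adjoin_induction with
    | mem r hr =>
      rcases hr with rfl | rfl
      · intro x hx; rw [hφ]; exact hA x hx
      · intro x hx; rw [hφ]; exact hC x hx
    | algebraMap c =>
      intro x hx
      rw [AlgHom.commutes, Module.algebraMap_end_apply, ← algebraMap_smul k c x]
      exact D.smul_mem _ hx
    | add r s _ _ hr hs =>
      intro x hx; rw [map_add]; exact D.add_mem (hr x hx) (hs x hx)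
    | mul r s _ _ hr hs =>
      intro x hx; rw [map_mul]; exact hr _ (hs x hx)
  have hmt : m ∣ Module.finrank k D := by
    -- The same matrix units, after scalar extension, restrict to the stable subspace `D`.
    refine dvd_finrank_of_matrixUnits (fun i j => (φ (e i j)).restrict (hD _ (he i j))) ?_ ?_
    · ext1 x
      apply Subtype.ext
      have h4 := congrArg (fun g => φ g x) h1
      simpa using h4
    · intro i j
      ext1 x
      apply Subtype.ext
      have h4 := congrArg (fun g => φ g x) (h2 i j)
      simpa using h4
  exact h3 (Nat.dvd_one.mp (hcop ▸ Nat.dvd_gcd hmt hmn))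

end Density

/-! ### The group `G A` over the rationals -/

section Rational

variable {n : ℕ}

theorem det_baseChange (F : Type*) [CommRing F] (A : Matrix (Fin n) (Fin n) ℤ) :
    (baseChange F A).det = ((A.det : ℤ) : F) :=
  (RingHom.map_det (Int.castRingHom F) A).symm

theorem isUnit_det_baseChange (F : Type*) [Field F] [CharZero F] {A : Matrix (Fin n) (Fin n) ℤ}
    (hA : A.det ≠ 0) : IsUnit (baseChange F A).det := by
  rw [det_baseChange]
  exact isUnit_iff_ne_zero.mpr (by exact_mod_cast hA)

theorem mem_G_iff {A : Matrix (Fin n) (Fin n) ℤ} (hA : A.det ≠ 0) {y : Fin n → ℚ} :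
    y ∈ G A ↔ ∃ (k : ℕ) (x : Fin n → ℤ), baseChange ℚ A ^ k *ᵥ y = fun i => (x i : ℚ) := by
  have hu := isUnit_det_baseChange ℚ hA
  constructor
  · rintro ⟨k, x, rfl⟩
    obtain ⟨z, hz⟩ := exists_eq_zpow_neg_mulVec A hA k k.natAbs (by omega) x
    refine ⟨k.natAbs, z, ?_⟩
    rw [hz, Matrix.mulVec_mulVec, ← zpow_natCast, ← Matrix.zpow_add hu]
    simp
  · rintro ⟨k, x, hx⟩
    refine ⟨k, x, ?_⟩
    rw [← hx, Matrix.mulVec_mulVec, ← zpow_natCast (baseChange ℚ A) k, ← Matrix.zpow_add hu]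
    simp

theorem intCast_mem_G {A : Matrix (Fin n) (Fin n) ℤ} (hA : A.det ≠ 0) (x : Fin n → ℤ) :
    (fun i => (x i : ℚ)) ∈ G A :=
  (mem_G_iff hA).mpr ⟨0, x, by simp⟩

theorem single_mem_G {A : Matrix (Fin n) (Fin n) ℤ} (hA : A.det ≠ 0) (j : Fin n) :
    (Pi.single j 1 : Fin n → ℚ) ∈ G A := by
  convert intCast_mem_G hA (Pi.single j 1) using 1
  funext i
  by_cases h : i = j
  · subst h; simp
  · simp [h]

theorem mulVec_mem_G {A : Matrix (Fin n) (Fin n) ℤ} (hA : A.det ≠ 0) {y : Fin n → ℚ}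
    (hy : y ∈ G A) : baseChange ℚ A *ᵥ y ∈ G A := by
  obtain ⟨k, x, hx⟩ := (mem_G_iff hA).mp hy
  refine (mem_G_iff hA).mpr ⟨k, A *ᵥ x, ?_⟩
  rw [Matrix.mulVec_mulVec, ← pow_succ, pow_succ', ← Matrix.mulVec_mulVec, hx,
    ← pow_one (baseChange ℚ A), baseChange_pow_mulVec, pow_one]

/-- `A` is invertible on `G A`; this divisibility later produces arbitrarily high powers of an
eigenvalue. -/
theorem exists_pow_mulVec_eq {A : Matrix (Fin n) (Fin n) ℤ} (hA : A.det ≠ 0) {y : Fin n → ℚ}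
    (hy : y ∈ G A) (m : ℕ) : ∃ z ∈ G A, baseChange ℚ A ^ m *ᵥ z = y := by
  have hu := isUnit_det_baseChange ℚ hA
  obtain ⟨k, x, hx⟩ := (mem_G_iff hA).mp hy
  have h : baseChange ℚ A ^ m *ᵥ (baseChange ℚ A ^ (-(m : ℤ)) *ᵥ y) = y := by
    rw [Matrix.mulVec_mulVec, ← zpow_natCast, ← Matrix.zpow_add hu]
    simp
  refine ⟨_, (mem_G_iff hA).mpr ⟨k + m, x, ?_⟩, h⟩
  rw [pow_add, ← Matrix.mulVec_mulVec, h, hx]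

end Rational

/-! ### The local groups, their contracted parts and `t p A` -/

section Local

variable {n : ℕ} (p : ℕ) [Fact p.Prime]

theorem norm_mulVec_le {p : ℕ} [Fact p.Prime] {M : Matrix (Fin n) (Fin n) ℚ_[p]} {c : ℝ}
    (hc : 0 ≤ c) (hM : ∀ i j, ‖M i j‖ ≤ c) (x : Fin n → ℚ_[p]) : ‖M *ᵥ x‖ ≤ c * ‖x‖ := by
  have h0 : 0 ≤ c * ‖x‖ := by positivity
  rw [pi_norm_le_iff_of_nonneg h0]
  intro i
  rw [Matrix.mulVec, dotProduct]
  refine IsUltrametricDist.norm_sum_le_of_forall_le_of_nonneg h0 fun j _ => ?_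
  rw [norm_mul]
  exact mul_le_mul (hM i j) (norm_le_pi_norm x j) (norm_nonneg _) hc

theorem norm_baseChange_mulVec_le (A : Matrix (Fin n) (Fin n) ℤ) (x : Fin n → ℚ_[p]) :
    ‖baseChange ℚ_[p] A *ᵥ x‖ ≤ ‖x‖ := by
  simpa using norm_mulVec_le (M := baseChange ℚ_[p] A) zero_le_one
    (fun i j => Padic.norm_int_le_one (A i j)) x

/-- An integral matrix does not increase the sup norm. Hence exponents can be enlarged freely, and
one small term bounds all later ones. -/
theorem antitone_norm_pow_mulVec (A : Matrix (Fin n) (Fin n) ℤ) (x : Fin n → ℚ_[p]) :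
    Antitone fun k : ℕ => ‖baseChange ℚ_[p] A ^ k *ᵥ x‖ :=
  antitone_nat_of_succ_le fun k => by
    rw [pow_succ', ← Matrix.mulVec_mulVec]
    exact norm_baseChange_mulVec_le p A _

/-- The image of a rational vector in `ℚ_pⁿ`. -/
abbrev padicVec (y : Fin n → ℚ) : Fin n → ℚ_[p] := fun i => (y i : ℚ_[p])

theorem map_mulVec_padicVec (M : Matrix (Fin n) (Fin n) ℚ) (y : Fin n → ℚ) :
    M.map (algebraMap ℚ ℚ_[p]) *ᵥ padicVec p y = padicVec p (M *ᵥ y) := by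
  funext i
  have := RingHom.map_mulVec (algebraMap ℚ ℚ_[p]) M y i
  simp only [eq_ratCast] at this
  rw [padicVec, this]
  simp [Matrix.mulVec, dotProduct]

theorem map_baseChange (F : Type*) [Field F] [Algebra ℚ F] (A : Matrix (Fin n) (Fin n) ℤ) :
    (baseChange ℚ A).map (algebraMap ℚ F) = baseChange F A := by
  ext i j
  simp

theorem baseChange_pow_padicVec (A : Matrix (Fin n) (Fin n) ℤ) (k : ℕ) (y : Fin n → ℚ) :
    baseChange ℚ_[p] A ^ k *ᵥ padicVec p y = padicVec p (baseChange ℚ A ^ k *ᵥ y) := by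
  rw [← map_mulVec_padicVec, Matrix.map_pow, map_baseChange]

theorem mem_Gbar_iff {A : Matrix (Fin n) (Fin n) ℤ} (hA : A.det ≠ 0) {y : Fin n → ℚ_[p]} :
    y ∈ Gbar p A ↔ ∃ k : ℕ, ‖baseChange ℚ_[p] A ^ k *ᵥ y‖ ≤ 1 := by
  constructor
  · intro hy
    induction hy using Submodule.span_induction with
    | mem y hy =>
      obtain ⟨z, hz, rfl⟩ := hy
      obtain ⟨k, x, hx⟩ := (mem_G_iff hA).mp hz
      refine ⟨k, ?_⟩
      change ‖_ *ᵥ padicVec p z‖ ≤ 1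
      rw [baseChange_pow_padicVec, hx, pi_norm_le_iff_of_nonneg zero_le_one]
      intro i
      simpa using Padic.norm_int_le_one (p := p) (x i)
    | zero => exact ⟨0, by simp⟩
    | add x y _ _ hx hy =>
      obtain ⟨k, hk⟩ := hx
      obtain ⟨l, hl⟩ := hy
      refine ⟨max k l, ?_⟩
      rw [Matrix.mulVec_add]
      refine (IsUltrametricDist.norm_add_le_max _ _).trans (max_le ?_ ?_)
      · exact (antitone_norm_pow_mulVec p A x (le_max_left k l)).trans hk
      · exact (antitone_norm_pow_mulVec p A y (le_max_right k l)).trans hl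
    | smul c x _ hx =>
      obtain ⟨k, hk⟩ := hx
      refine ⟨k, ?_⟩
      have h : c • x = (c : ℚ_[p]) • x := rfl
      rw [h, Matrix.mulVec_smul, norm_smul]
      exact mul_le_one₀ c.norm_le_one (norm_nonneg _) hk
  · rintro ⟨k, hk⟩
    have hu := isUnit_det_baseChange ℚ_[p] hA
    set z := baseChange ℚ_[p] A ^ k *ᵥ y with hz
    -- Write `e_j = A ^ k w_j` with `w_j` in `G A`; then `y` is the combination of the `w_j` with
    -- the integral coordinates of `A ^ k y`.
    choose w hw hwe using fun j => exists_pow_mulVec_eq hA (single_mem_G hA j) k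
    have hy : y = ∑ j, z j • padicVec p (w j) := by
      have hinj : Function.Injective ((baseChange ℚ_[p] A ^ k).mulVec) := by
        apply Matrix.mulVec_injective_of_isUnit
        rw [Matrix.isUnit_iff_isUnit_det, Matrix.det_pow]
        exact hu.pow k
      apply hinj
      rw [← hz, Matrix.mulVec_sum]
      simp_rw [Matrix.mulVec_smul, baseChange_pow_padicVec, hwe]
      funext i
      rw [Finset.sum_apply, Finset.sum_eq_single i]
      · simp [padicVec]
      · intro j _ hj
        simp [padicVec, hj.symm]
      · simp
    rw [hy]
    refine Submodule.sum_mem _ fun j _ => ?_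
    exact (Gbar p A).smul_mem (⟨z j, (norm_le_pi_norm z j).trans hk⟩ : ℤ_[p])
      (Submodule.subset_span ⟨w j, hw j, rfl⟩)

theorem mem_Gbar_of_norm_le_one {A : Matrix (Fin n) (Fin n) ℤ} (hA : A.det ≠ 0)
    {y : Fin n → ℚ_[p]} (hy : ‖y‖ ≤ 1) : y ∈ Gbar p A :=
  (mem_Gbar_iff p hA).mpr ⟨0, by simpa using hy⟩

/-- The subspace of `ℚ_pⁿ` contracted by the powers of `A`. It is the divisible part of
`Gbar p A`, see `mem_contracted_iff`. -/
def contracted (A : Matrix (Fin n) (Fin n) ℤ) : Submodule ℚ_[p] (Fin n → ℚ_[p]) where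
  carrier := {y | Filter.Tendsto (fun k : ℕ => baseChange ℚ_[p] A ^ k *ᵥ y) Filter.atTop (nhds 0)}
  zero_mem' := by simp
  add_mem' := by
    intro x y hx hy
    simpa [Matrix.mulVec_add] using Filter.Tendsto.add hx hy
  smul_mem' := by
    intro c x hx
    simpa [Matrix.mulVec_smul] using Filter.Tendsto.const_smul hx c

theorem mem_contracted_of_exists {A : Matrix (Fin n) (Fin n) ℤ} {y : Fin n → ℚ_[p]}
    (h : ∀ ε > 0, ∃ k : ℕ, ‖baseChange ℚ_[p] A ^ k *ᵥ y‖ < ε) : y ∈ contracted p A := by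
  change Filter.Tendsto _ _ _
  rw [Metric.tendsto_atTop]
  intro ε hε
  obtain ⟨k, hk⟩ := h ε hε
  refine ⟨k, fun l hl => ?_⟩
  rw [dist_zero_right]
  exact (antitone_norm_pow_mulVec p A y hl).trans_lt hk

theorem exists_norm_lt_of_mem_contracted {A : Matrix (Fin n) (Fin n) ℤ} {y : Fin n → ℚ_[p]}
    (h : y ∈ contracted p A) {ε : ℝ} (hε : 0 < ε) :
    ∃ k : ℕ, ‖baseChange ℚ_[p] A ^ k *ᵥ y‖ < ε := by
  obtain ⟨k, hk⟩ := Metric.tendsto_atTop.mp h ε hε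
  exact ⟨k, by simpa using hk k le_rfl⟩

/-- If every multiple `c y` becomes integral under some power of `A`, taking `‖c‖` large makes `A ^
k y` arbitrarily small. -/
theorem mem_contracted_iff {A : Matrix (Fin n) (Fin n) ℤ} (hA : A.det ≠ 0)
    {y : Fin n → ℚ_[p]} : y ∈ contracted p A ↔ ∀ c : ℚ_[p], c • y ∈ Gbar p A := by
  constructor
  · intro h c
    obtain ⟨k, hk⟩ := exists_norm_lt_of_mem_contracted p ((contracted p A).smul_mem c h) one_pos
    exact (mem_Gbar_iff p hA).mpr ⟨k, hk.le⟩
  · intro h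
    refine mem_contracted_of_exists p fun ε hε => ?_
    obtain ⟨c, hc⟩ := NormedField.exists_lt_norm ℚ_[p] ε⁻¹
    obtain ⟨k, hk⟩ := (mem_Gbar_iff p hA).mp (h c)
    refine ⟨k, ?_⟩
    rw [Matrix.mulVec_smul, norm_smul] at hk
    have hc0 : 0 < ‖c‖ := lt_trans (by positivity) hc
    calc ‖baseChange ℚ_[p] A ^ k *ᵥ y‖ ≤ 1 / ‖c‖ := by rw [le_div_iff₀ hc0, mul_comm]; exact hk
      _ < ε := by rw [one_div]; exact inv_lt_of_inv_lt₀ hε hc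

theorem contracted_le_Gbar {A : Matrix (Fin n) (Fin n) ℤ} (hA : A.det ≠ 0)
    {y : Fin n → ℚ_[p]} (h : y ∈ contracted p A) : y ∈ Gbar p A := by
  simpa using (mem_contracted_iff p hA).mp h 1

variable {p}

/-- The adjugate is integral too, and its product with `A` is the `p`-adic unit `det A`. -/
theorem norm_mulVec_eq_of_not_dvd {A : Matrix (Fin n) (Fin n) ℤ} (hp : ¬ (p : ℤ) ∣ A.det)
    (x : Fin n → ℚ_[p]) : ‖baseChange ℚ_[p] A *ᵥ x‖ = ‖x‖ := by
  refine le_antisymm (norm_baseChange_mulVec_le p A x) ?_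
  have h1 : baseChange ℚ_[p] A.adjugate *ᵥ (baseChange ℚ_[p] A *ᵥ x) =
      ((A.det : ℤ) : ℚ_[p]) • x := by
    rw [Matrix.mulVec_mulVec, ← Matrix.map_mul, Matrix.adjugate_mul]
    have : (A.det • (1 : Matrix (Fin n) (Fin n) ℤ)).map (Int.castRingHom ℚ_[p]) =
        ((A.det : ℤ) : ℚ_[p]) • 1 := by
      rw [Matrix.map_smul' _ _ _ (map_mul _)]
      simp
    rw [this, Matrix.smul_mulVec, Matrix.one_mulVec]
  have h2 := norm_baseChange_mulVec_le p A.adjugate (baseChange ℚ_[p] A *ᵥ x)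
  have h3 : ‖((A.det : ℤ) : ℚ_[p])‖ = 1 := by
    refine le_antisymm (Padic.norm_int_le_one _) (not_lt.mp fun h => hp ?_)
    exact (PadicInt.norm_int_lt_one_iff_dvd _).mp (by simpa [PadicInt.norm_def] using h)
  rw [h1, norm_smul, h3, one_mul] at h2
  exact h2

theorem norm_pow_mulVec_eq_of_not_dvd {A : Matrix (Fin n) (Fin n) ℤ} (hp : ¬ (p : ℤ) ∣ A.det)
    (x : Fin n → ℚ_[p]) (k : ℕ) : ‖baseChange ℚ_[p] A ^ k *ᵥ x‖ = ‖x‖ := by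
  induction k with
  | zero => simp
  | succ k ih => rw [pow_succ', ← Matrix.mulVec_mulVec, norm_mulVec_eq_of_not_dvd hp, ih]

theorem contracted_eq_bot {A : Matrix (Fin n) (Fin n) ℤ} (hp : ¬ (p : ℤ) ∣ A.det) :
    contracted p A = ⊥ := by
  rw [eq_bot_iff]
  intro x hx
  by_contra hne
  obtain ⟨k, hk⟩ := exists_norm_lt_of_mem_contracted p hx (norm_pos_iff.mpr hne)
  rw [norm_pow_mulVec_eq_of_not_dvd hp] at hk
  exact lt_irrefl _ hk

/-- Cayley–Hamilton modulo `p` gives `A ^ n ≡ 0`, so `A ^ n` shrinks norms by a factor `1 / p`. -/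
theorem contracted_eq_top {A : Matrix (Fin n) (Fin n) ℤ}
    (h : A.charpoly.map (Int.castRingHom (ZMod p)) = Polynomial.X ^ n) :
    contracted p A = ⊤ := by
  have h1 : (A ^ n).map (Int.castRingHom (ZMod p)) = 0 := by
    rw [Matrix.map_pow]
    have h2 := Matrix.aeval_self_charpoly (A.map (Int.castRingHom (ZMod p)))
    rwa [Matrix.charpoly_map, h, map_pow, Polynomial.aeval_X] at h2
  have h2 : ∀ x : Fin n → ℚ_[p], ‖baseChange ℚ_[p] A ^ n *ᵥ x‖ ≤ (p : ℝ)⁻¹ * ‖x‖ := by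
    intro x
    refine norm_mulVec_le (by positivity) (fun i j => ?_) x
    rw [← Matrix.map_pow]
    have h3 : ((A ^ n) i j : ZMod p) = 0 := congrFun (congrFun h1 i) j
    rw [ZMod.intCast_zmod_eq_zero_iff_dvd] at h3
    have h4 := (Padic.norm_int_le_pow_iff_dvd (p := p) ((A ^ n) i j) 1).mpr (by simpa using h3)
    simpa using h4
  have h3 : ∀ (x : Fin n → ℚ_[p]) (k : ℕ),
      ‖baseChange ℚ_[p] A ^ (n * k) *ᵥ x‖ ≤ ((p : ℝ)⁻¹) ^ k * ‖x‖ := by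
    intro x k
    induction k with
    | zero => simp
    | succ k ih =>
      rw [mul_add, mul_one, add_comm, pow_add, ← Matrix.mulVec_mulVec, pow_succ', mul_assoc]
      exact (h2 _).trans (mul_le_mul_of_nonneg_left ih (by positivity))
  have hp1 : (p : ℝ)⁻¹ < 1 := inv_lt_one_of_one_lt₀ (by exact_mod_cast (Fact.out : p.Prime).one_lt)
  rw [eq_top_iff]
  intro x _
  refine mem_contracted_of_exists p fun ε hε => ?_
  have h4 : Filter.Tendsto (fun k : ℕ => ((p : ℝ)⁻¹) ^ k * ‖x‖) Filter.atTop (nhds (0 * ‖x‖)) :=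
    (tendsto_pow_atTop_nhds_zero_of_lt_one (by positivity) hp1).mul_const _
  rw [zero_mul] at h4
  obtain ⟨k, hk⟩ := (h4.eventually (gt_mem_nhds hε)).exists
  exact ⟨n * k, (h3 x k).trans_lt hk⟩

theorem map_charpoly_monic (p : ℕ) (A : Matrix (Fin n) (Fin n) ℤ) :
    (A.charpoly.map (Int.castRingHom (ZMod p))).Monic :=
  (Matrix.charpoly_monic A).map _

theorem natDegree_map_charpoly (A : Matrix (Fin n) (Fin n) ℤ) :
    (A.charpoly.map (Int.castRingHom (ZMod p))).natDegree = n := by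
  rw [(Matrix.charpoly_monic A).natDegree_map, Matrix.charpoly_natDegree_eq_dim, Fintype.card_fin]

theorem t_le (A : Matrix (Fin n) (Fin n) ℤ) : t p A ≤ n := by
  have h := Polynomial.natDegree_le_of_dvd
    (Polynomial.pow_rootMultiplicity_dvd (A.charpoly.map (Int.castRingHom (ZMod p))) 0)
    (map_charpoly_monic p A).ne_zero
  rwa [natDegree_map_charpoly, map_zero, sub_zero, Polynomial.natDegree_X_pow] at h

theorem t_pos_iff {A : Matrix (Fin n) (Fin n) ℤ} : 0 < t p A ↔ (p : ℤ) ∣ A.det := by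
  rw [t, Polynomial.rootMultiplicity_pos (map_charpoly_monic p A).ne_zero, Polynomial.IsRoot,
    ← Polynomial.coeff_zero_eq_eval_zero, Polynomial.coeff_map, Matrix.det_eq_sign_charpoly_coeff]
  rw [eq_intCast, ZMod.intCast_zmod_eq_zero_iff_dvd]
  exact ((isUnit_one.neg.pow _).dvd_mul_left).symm

theorem t_eq_iff {A : Matrix (Fin n) (Fin n) ℤ} :
    t p A = n ↔ A.charpoly.map (Int.castRingHom (ZMod p)) = Polynomial.X ^ n := by
  constructor
  · intro h
    have h1 := Polynomial.pow_rootMultiplicity_dvd (A.charpoly.map (Int.castRingHom (ZMod p))) 0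
    change _ ^ t p A ∣ _ at h1
    rw [h, map_zero, sub_zero] at h1
    refine Polynomial.eq_of_monic_of_dvd_of_natDegree_le (Polynomial.monic_X_pow n)
      (map_charpoly_monic p A) h1 ?_
    rw [natDegree_map_charpoly, Polynomial.natDegree_X_pow]
  · intro h
    rw [t, h]
    simpa using Polynomial.rootMultiplicity_X_sub_C_pow (0 : ZMod p) n

/-- Membership depends on `t p A` alone, so it transfers between `A` and `B` once their
multiplicities agree. -/
theorem mem_P'_iff {A : Matrix (Fin n) (Fin n) ℤ} : p ∈ P' A ↔ 0 < t p A ∧ t p A < n := by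
  rw [t_pos_iff, (t_le A).lt_iff_ne, Ne, t_eq_iff]
  exact ⟨fun h => h.2, fun h => ⟨Fact.out, h⟩⟩

end Local

/-! ### Coordinates adapted to the characteristic -/

section Characteristic

variable {n : ℕ} {p : ℕ} [Fact p.Prime]

theorem xVec_apply (t : ℕ) (α : Fin n → Fin n → ℤ_[p]) (i k : Fin n) :
    xVec p t α i k =
      (Pi.single i 1 : Fin n → ℚ_[p]) k + if t ≤ (k : ℕ) then (α i k : ℚ_[p]) else 0 := by
  rw [xVec, Pi.add_apply, Finset.sum_apply, Finset.sum_filter, Finset.sum_eq_single k]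
  · simp
  · intro j _ hj
    simp [hj.symm]
  · simp

/-- The coordinate of `y` at the basis vector `e_k`, `k ≥ t`, of the basis
`x_i` (`i < t`), `e_k` (`t ≤ k`). -/
def defect (t : ℕ) (α : Fin n → Fin n → ℤ_[p]) (k : Fin n) : (Fin n → ℚ_[p]) →ₗ[ℚ_[p]] ℚ_[p] where
  toFun y := y k - ∑ i ∈ Finset.univ.filter (fun i : Fin n => (i : ℕ) < t),
    y i * (α i k : ℚ_[p])
  map_add' x y := by simp [add_mul, Finset.sum_add_distrib]; ring
  map_smul' c x := by simp [mul_sub, Finset.mul_sum, mul_assoc]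

theorem defect_apply (t : ℕ) (α : Fin n → Fin n → ℤ_[p]) (k : Fin n) (y : Fin n → ℚ_[p]) :
    defect t α k y = y k - ∑ i ∈ Finset.univ.filter (fun i : Fin n => (i : ℕ) < t),
      y i * (α i k : ℚ_[p]) := rfl

theorem defect_xVec {t : ℕ} (α : Fin n → Fin n → ℤ_[p]) {i k : Fin n} (hi : (i : ℕ) < t)
    (hk : t ≤ (k : ℕ)) : defect t α k (xVec p t α i) = 0 := by
  have hne : k ≠ i := by rintro rfl; omega
  rw [defect_apply, Finset.sum_eq_single i]
  · simp [xVec_apply, hk, hne, hi.not_ge]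
  · intro j hj hji
    have hj' : (j : ℕ) < t := by simpa using hj
    simp [xVec_apply, hji, hj'.not_ge]
  · intro h
    exact absurd hi (by simpa using h)

theorem defect_single {t : ℕ} (α : Fin n → Fin n → ℤ_[p]) {j : Fin n} (k : Fin n)
    (hj : t ≤ (j : ℕ)) :
    defect t α k (Pi.single j 1) = (Pi.single j 1 : Fin n → ℚ_[p]) k := by
  rw [defect_apply, Finset.sum_eq_zero, sub_zero]
  intro i hi
  have hi' : (i : ℕ) < t := by simpa using hi
  have : i ≠ j := by rintro rfl; omega
  simp [this]

theorem eq_sum_xVec_add_sum_single (t : ℕ) (α : Fin n → Fin n → ℤ_[p]) (y : Fin n → ℚ_[p]) :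
    y = ∑ i ∈ Finset.univ.filter (fun i : Fin n => (i : ℕ) < t), y i • xVec p t α i +
      ∑ k ∈ Finset.univ.filter (fun k : Fin n => t ≤ (k : ℕ)),
        defect t α k y • Pi.single k 1 := by
  funext k
  simp only [Pi.add_apply, Finset.sum_apply, Pi.smul_apply, smul_eq_mul, xVec_apply]
  by_cases hk : t ≤ (k : ℕ)
  · rw [Finset.sum_eq_single (s := Finset.univ.filter (fun k : Fin n => t ≤ (k : ℕ))) k]
    · simp only [hk, if_true, mul_add, Finset.sum_add_distrib, defect_apply]
      rw [Finset.sum_eq_zero]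
      · simp
      · intro i hi
        have hi' : (i : ℕ) < t := by simpa using hi
        have : k ≠ i := by rintro rfl; omega
        simp [this]
    · intro j _ hj
      simp [hj.symm]
    · intro h
      exact absurd hk (by simpa using h)
  · rw [Finset.sum_eq_single k, Finset.sum_eq_zero]
    · simp [hk]
    · intro j hj
      have hj' : t ≤ (j : ℕ) := by simpa using hj
      have : k ≠ j := by rintro rfl; omega
      simp [this]
    · intro j _ hj
      simp [hj.symm, hk]
    · intro h
      exact absurd (not_le.mp hk) (by simpa using h)

variable {A : Matrix (Fin n) (Fin n) ℤ} {α : ∀ (p : ℕ) [Fact p.Prime], Fin n → Fin n → ℤ_[p]}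

/-- In the basis `x_i`, `e_k` the local group is `ℚ_p ^ t ⊕ ℤ_p ^ (n - t)`, and the defects are the
last `n - t` coordinates. -/
theorem mem_Gbar_iff_defect (hα : IsCharacteristic A α) (hp : p ∈ P' A) {y : Fin n → ℚ_[p]} :
    y ∈ Gbar p A ↔ ∀ k : Fin n, t p A ≤ (k : ℕ) → ‖defect (t p A) (α p) k y‖ ≤ 1 := by
  rw [hα p hp]
  constructor
  · intro hy k hk
    obtain ⟨s, hs, e, he, rfl⟩ := Submodule.mem_sup.mp hy
    have h1 : defect (t p A) (α p) k s = 0 := by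
      clear hy
      replace hs : s ∈ Submodule.span ℚ_[p] _ := hs
      induction hs using Submodule.span_induction with
      | mem s hs =>
        obtain ⟨i, hi, rfl⟩ := hs
        exact defect_xVec _ hi hk
      | zero => simp
      | add x y _ _ hx hy => rw [map_add, hx, hy, add_zero]
      | smul c x _ hx => rw [map_smul, hx, smul_zero]
    rw [map_add, h1, zero_add]
    clear hy h1
    induction he using Submodule.span_induction with
    | mem s hs =>
      obtain ⟨j, hj, rfl⟩ := hs
      rw [defect_single _ _ hj, Pi.single_apply]
      split_ifs <;> simp
    | zero => simp
    | add x y _ _ hx hy =>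
      rw [map_add]
      exact (IsUltrametricDist.norm_add_le_max _ _).trans (max_le hx hy)
    | smul c x _ hx =>
      have h : c • x = (c : ℚ_[p]) • x := rfl
      rw [h, map_smul, norm_smul]
      exact mul_le_one₀ c.norm_le_one (norm_nonneg _) hx
  · intro h
    rw [eq_sum_xVec_add_sum_single (t p A) (α p) y]
    refine Submodule.add_mem_sup ?_ ?_
    · refine Submodule.sum_mem _ fun i hi => ?_
      exact Submodule.smul_mem (Submodule.span ℚ_[p] _) _
        (Submodule.subset_span ⟨i, by simpa using hi, rfl⟩)
    · refine Submodule.sum_mem _ fun k hk => ?_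
      have hk' : t p A ≤ (k : ℕ) := by simpa using hk
      let d : ℤ_[p] := ⟨_, h k hk'⟩
      exact Submodule.smul_mem _ d (Submodule.subset_span ⟨k, hk', rfl⟩)

theorem mem_contracted_iff_defect (hA : A.det ≠ 0) (hα : IsCharacteristic A α) (hp : p ∈ P' A)
    {y : Fin n → ℚ_[p]} :
    y ∈ contracted p A ↔ ∀ k : Fin n, t p A ≤ (k : ℕ) → defect (t p A) (α p) k y = 0 := by
  rw [mem_contracted_iff p hA]
  simp_rw [mem_Gbar_iff_defect hα hp, map_smul, norm_smul]
  constructor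
  · intro h k hk
    by_contra hne
    obtain ⟨c, hc⟩ := NormedField.exists_lt_norm ℚ_[p] ‖defect (t p A) (α p) k y‖⁻¹
    have hpos : 0 < ‖defect (t p A) (α p) k y‖ := norm_pos_iff.mpr hne
    have h1 := h c k hk
    rw [← le_div_iff₀ hpos, one_div] at h1
    exact absurd h1 (not_le.mpr hc)
  · intro h c k hk
    simp [h k hk]

/-- The dimension of the divisible part of `G_A ⊗ ℤ_p` is `t_p(A)`. -/
theorem finrank_contracted (hA : A.det ≠ 0) (hα : IsCharacteristic A α) :
    Module.finrank ℚ_[p] (contracted p A) = t p A := by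
  by_cases hd : (p : ℤ) ∣ A.det
  · by_cases hX : A.charpoly.map (Int.castRingHom (ZMod p)) = Polynomial.X ^ n
    · rw [contracted_eq_top hX, t_eq_iff.mpr hX]
      simp
    · have hp : p ∈ P' A := ⟨Fact.out, hd, hX⟩
      let φ : (Fin n → ℚ_[p]) →ₗ[ℚ_[p]] ({k : Fin n // t p A ≤ (k : ℕ)} → ℚ_[p]) :=
        LinearMap.pi fun k => defect (t p A) (α p) k
      have hker : LinearMap.ker φ = contracted p A := by
        ext y
        rw [mem_contracted_iff_defect hA hα hp, LinearMap.mem_ker, funext_iff, Subtype.forall]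
        rfl
      have hrange : LinearMap.range φ = ⊤ := by
        rw [LinearMap.range_eq_top]
        intro z
        -- A vector supported on the indices `≥ t` has zero correction sum, so its defects are its
        -- coordinates.
        refine ⟨fun k => if hk : t p A ≤ (k : ℕ) then z ⟨k, hk⟩ else 0, ?_⟩
        funext k
        change defect _ _ _ _ = _
        rw [defect_apply, Finset.sum_eq_zero]
        · simp [k.2]
        · intro i hi
          have hi' : (i : ℕ) < t p A := by simpa using hi
          simp [hi'.not_ge]
      have h1 := LinearMap.finrank_range_add_finrank_ker φ
      rw [hker, hrange, finrank_top, Module.finrank_fintype_fun_eq_card,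
        Module.finrank_fintype_fun_eq_card, Fintype.card_fin] at h1
      have h2 : Fintype.card {k : Fin n // t p A ≤ (k : ℕ)} = n - t p A := by
        rw [Fintype.card_subtype]
        have := Fin.card_filter_val_lt (n := n) (m := t p A)
        have h3 := Finset.card_filter_add_card_filter_not (s := (Finset.univ : Finset (Fin n)))
          (fun k => (k : ℕ) < t p A)
        have ht := t_le (p := p) A
        simp only [not_lt, Finset.card_univ, Fintype.card_fin] at h3
        omega
      have ht := t_le (p := p) A
      omega
  · rw [contracted_eq_bot hd, finrank_bot]
    have := t_pos_iff (p := p) (A := A)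
    by_contra h
    exact hd (this.mp (Nat.pos_of_ne_zero (Ne.symm h)))

end Characteristic

/-! ### From local to global membership -/

section LocalGlobal

variable {n : ℕ}

theorem den_eq_one_of_norm_le_one {q : ℚ}
    (h : ∀ (p : ℕ) [Fact p.Prime], ‖(q : ℚ_[p])‖ ≤ 1) : q.den = 1 := by
  by_contra hne
  obtain ⟨p, hp, hd⟩ := Nat.exists_prime_and_dvd hne
  have : Fact p.Prime := ⟨hp⟩
  have h1 : ‖((q.den : ℤ) : ℚ_[p])‖ < 1 := by
    have := (PadicInt.norm_int_lt_one_iff_dvd (p := p) q.den).mpr (by exact_mod_cast hd)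
    simpa [PadicInt.norm_def] using this
  have h2 : ‖((q.num : ℤ) : ℚ_[p])‖ < 1 := by
    have h3 : ((q.num : ℤ) : ℚ_[p]) = (q : ℚ_[p]) * ((q.den : ℤ) : ℚ_[p]) := by
      have := Rat.mul_den_eq_num q
      have := congrArg (fun r : ℚ => (r : ℚ_[p])) this
      push_cast at this ⊢
      exact this.symm
    rw [h3, norm_mul]
    exact (mul_le_of_le_one_left (norm_nonneg _) (h p)).trans_lt h1
  have h3 : (p : ℤ) ∣ q.num :=
    (PadicInt.norm_int_lt_one_iff_dvd (p := p) q.num).mp (by simpa [PadicInt.norm_def] using h2)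
  have h4 := Nat.dvd_gcd (Int.natCast_dvd.mp h3) hd
  rw [q.reduced.gcd_eq_one] at h4
  exact hp.one_lt.ne' (Nat.dvd_one.mp h4)

/-- Only finitely many primes divide the denominators of `x`, so one exponent makes `B ^ N x`
integral at every prime, hence integral. -/
theorem mem_G_of_forall_mem_Gbar {B : Matrix (Fin n) (Fin n) ℤ} (hB : B.det ≠ 0) {x : Fin n → ℚ}
    (h : ∀ (p : ℕ) [Fact p.Prime], padicVec p x ∈ Gbar p B) : x ∈ G B := by
  have h1 : ∀ p : ℕ, ∃ k : ℕ, ∀ [Fact p.Prime], ‖baseChange ℚ_[p] B ^ k *ᵥ padicVec p x‖ ≤ 1 := by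
    intro p
    by_cases hp : p.Prime
    · have : Fact p.Prime := ⟨hp⟩
      obtain ⟨k, hk⟩ := (mem_Gbar_iff p hB).mp (h p)
      exact ⟨k, hk⟩
    · exact ⟨0, fun {hp'} => absurd hp'.out hp⟩
  choose k hk using h1
  let d := ∏ i, (x i).den
  have hd : d ≠ 0 := Finset.prod_ne_zero_iff.mpr fun i _ => (x i).den_nz
  let N := d.primeFactors.sup k
  have h2 : ∀ (p : ℕ) [Fact p.Prime], ‖baseChange ℚ_[p] B ^ N *ᵥ padicVec p x‖ ≤ 1 := by
    intro p hp
    by_cases hpd : p ∣ d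
    · exact (antitone_norm_pow_mulVec p B _ (Finset.le_sup
        (Nat.mem_primeFactors.mpr ⟨hp.out, hpd, hd⟩))).trans (hk p)
    · refine (antitone_norm_pow_mulVec p B _ (Nat.zero_le N)).trans ?_
      simp only [pow_zero, Matrix.one_mulVec]
      rw [pi_norm_le_iff_of_nonneg zero_le_one]
      intro i
      exact Padic.norm_rat_le_one fun hi => hpd (hi.trans (Finset.dvd_prod_of_mem _ (by simp)))
  refine (mem_G_iff hB).mpr ⟨N, fun i => ((baseChange ℚ B ^ N *ᵥ x) i).num, ?_⟩
  funext i
  have h3 : ((baseChange ℚ B ^ N *ᵥ x) i).den = 1 := by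
    refine den_eq_one_of_norm_le_one fun p hp => ?_
    have h4 := h2 p
    rw [baseChange_pow_padicVec] at h4
    exact (norm_le_pi_norm _ i).trans h4
  exact (Rat.den_eq_one_iff _).mp h3 |>.symm

theorem map_mulVec_mem_Gbar {A B : Matrix (Fin n) (Fin n) ℤ} {T : Matrix (Fin n) (Fin n) ℚ}
    (h : ∀ x ∈ G A, T *ᵥ x ∈ G B) {p : ℕ} [Fact p.Prime] {y : Fin n → ℚ_[p]} (hy : y ∈ Gbar p A) :
    T.map (algebraMap ℚ ℚ_[p]) *ᵥ y ∈ Gbar p B := by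
  induction hy using Submodule.span_induction with
  | mem y hy =>
    obtain ⟨z, hz, rfl⟩ := hy
    exact Submodule.subset_span ⟨_, h z hz, (map_mulVec_padicVec p T z).symm⟩
  | zero => simp
  | add x y _ _ hx hy => rw [Matrix.mulVec_add]; exact add_mem hx hy
  | smul c x _ hx =>
    have h : c • x = (c : ℚ_[p]) • x := rfl
    rw [h, Matrix.mulVec_smul]
    exact Submodule.smul_mem _ c hx

/-- The contracted part is determined by the local group, as its largest `ℚ_p`-subspace, so
homomorphisms respect it. -/
theorem map_mulVec_mem_contracted {A B : Matrix (Fin n) (Fin n) ℤ} (hA : A.det ≠ 0)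
    (hB : B.det ≠ 0) {T : Matrix (Fin n) (Fin n) ℚ}
    (h : ∀ x ∈ G A, T *ᵥ x ∈ G B) {p : ℕ} [Fact p.Prime] {y : Fin n → ℚ_[p]}
    (hy : y ∈ contracted p A) : T.map (algebraMap ℚ ℚ_[p]) *ᵥ y ∈ contracted p B := by
  rw [mem_contracted_iff p hB]
  intro c
  rw [← Matrix.mulVec_smul]
  exact map_mulVec_mem_Gbar h ((mem_contracted_iff p hA).mp hy c)

theorem mulVec_mem_contracted {A : Matrix (Fin n) (Fin n) ℤ} (hA : A.det ≠ 0)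
    {p : ℕ} [Fact p.Prime] {y : Fin n → ℚ_[p]} (hy : y ∈ contracted p A) :
    baseChange ℚ_[p] A *ᵥ y ∈ contracted p A := by
  rw [← map_baseChange]
  exact map_mulVec_mem_contracted hA hA (fun x hx => mulVec_mem_G hA hx) hy

/-- `T e_j` lies in `G_B ⊗ ℤ_p` for all `j > t` if and only if `T` satisfies the condition at
`p`. -/
theorem satisfiesCondition_iff {B : Matrix (Fin n) (Fin n) ℤ} {p : ℕ} [Fact p.Prime]
    {β : ∀ (p : ℕ) [Fact p.Prime], Fin n → Fin n → ℤ_[p]} (hβ : IsCharacteristic B β)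
    (hp : p ∈ P' B) {T : Matrix (Fin n) (Fin n) ℚ} :
    SatisfiesCondition B p (β p) T ↔ ∀ j : Fin n, t p B ≤ (j : ℕ) →
      T.map (algebraMap ℚ ℚ_[p]) *ᵥ Pi.single j 1 ∈ Gbar p B := by
  simp_rw [mem_Gbar_iff_defect hβ hp, defect_apply, SatisfiesCondition, PadicInt.mem_subring_iff]
  constructor
  · intro h j hj k hk
    simpa using h k j hk hj
  · intro h k j hk hj
    simpa using h j hj k hk

end LocalGlobal

/-! ### Boundedness of the powers of an integral matrix -/

section IntegralMatrix

variable {n : ℕ}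

/-- The powers of an integral rational matrix have a common denominator. -/
theorem exists_denominator_pow_of_isIntegral {M : Matrix (Fin n) (Fin n) ℚ} (hM : IsIntegral ℤ M) :
    ∃ N : ℤ, N ≠ 0 ∧ ∀ (k : ℕ) i j, ∃ z : ℤ, (N : ℚ) * (M ^ k) i j = z := by
  -- `ℤ[M]` is finitely generated over `ℤ`; a common denominator for the entries of the generators
  -- serves all powers.
  obtain ⟨s, hs⟩ := hM.fg_adjoin_singleton
  obtain ⟨d, hd⟩ := IsLocalization.exist_integer_multiples (nonZeroDivisors ℤ)
    (s ×ˢ (Finset.univ : Finset (Fin n × Fin n)))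
    (fun x : Matrix (Fin n) (Fin n) ℚ × (Fin n × Fin n) => x.1 x.2.1 x.2.2)
  refine ⟨d, nonZeroDivisors.ne_zero d.2, fun k i j => ?_⟩
  have hk : M ^ k ∈ Submodule.span ℤ (s : Set (Matrix (Fin n) (Fin n) ℚ)) := by
    rw [hs, Subalgebra.mem_toSubmodule]
    exact pow_mem (Algebra.subset_adjoin (Set.mem_singleton _)) k
  generalize M ^ k = X at hk ⊢
  induction hk using Submodule.span_induction with
  | mem x hx =>
    obtain ⟨z, hz⟩ := hd (x, (i, j)) (by simpa using hx)
    refine ⟨z, ?_⟩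
    rw [eq_intCast] at hz
    rw [hz, zsmul_eq_mul]
  | zero => exact ⟨0, by simp⟩
  | add x y _ _ hx hy =>
    obtain ⟨z, hz⟩ := hx
    obtain ⟨w, hw⟩ := hy
    exact ⟨z + w, by rw [Matrix.add_apply, mul_add, hz, hw]; push_cast; rfl⟩
  | smul c x _ hx =>
    obtain ⟨z, hz⟩ := hx
    refine ⟨c * z, ?_⟩
    rw [Matrix.smul_apply, zsmul_eq_mul, mul_left_comm, hz]
    push_cast; rfl

theorem exists_norm_pow_le_of_isIntegral (p : ℕ) [Fact p.Prime] {M : Matrix (Fin n) (Fin n) ℚ}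
    (hM : IsIntegral ℤ M) :
    ∃ c : ℝ, 0 < c ∧ ∀ (k : ℕ) (x : Fin n → ℚ_[p]),
      ‖M.map (algebraMap ℚ ℚ_[p]) ^ k *ᵥ x‖ ≤ c * ‖x‖ := by
  obtain ⟨N, hN, h⟩ := exists_denominator_pow_of_isIntegral hM
  have hN0 : 0 < ‖((N : ℤ) : ℚ_[p])‖ := norm_pos_iff.mpr (by exact_mod_cast hN)
  refine ⟨‖((N : ℤ) : ℚ_[p])‖⁻¹, inv_pos.mpr hN0, fun k x => ?_⟩
  refine norm_mulVec_le (inv_pos.mpr hN0).le (fun i j => ?_) x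
  obtain ⟨z, hz⟩ := h k i j
  rw [← Matrix.map_pow, Matrix.map_apply, eq_ratCast, ← one_div, le_div_iff₀ hN0, mul_comm,
    ← norm_mul]
  have h1 := congrArg (fun r : ℚ => (r : ℚ_[p])) hz
  push_cast at h1
  rw [h1]
  exact Padic.norm_int_le_one z

theorem exists_norm_mulVec_le (p : ℕ) [Fact p.Prime] (T : Matrix (Fin n) (Fin n) ℚ_[p]) :
    ∃ c : ℝ, 0 < c ∧ ∀ x : Fin n → ℚ_[p], ‖T *ᵥ x‖ ≤ c * ‖x‖ := by
  refine ⟨1 + ∑ i, ∑ j, ‖T i j‖, by positivity, fun x => ?_⟩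
  refine norm_mulVec_le (by positivity) (fun i j => ?_) x
  have h1 : ‖T i j‖ ≤ ∑ j, ‖T i j‖ :=
    Finset.single_le_sum (f := fun j => ‖T i j‖) (fun j _ => norm_nonneg _) (Finset.mem_univ j)
  have h2 : ∑ j, ‖T i j‖ ≤ ∑ i, ∑ j, ‖T i j‖ :=
    Finset.single_le_sum (f := fun i => ∑ j, ‖T i j‖)
      (fun i _ => Finset.sum_nonneg fun j _ => norm_nonneg _) (Finset.mem_univ i)
  linarith

/-- Iteration gives `B ^ (m k) T = T M ^ k A ^ k`. The powers of `M` are bounded, so smallness of `A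
^ k y` passes to `B ^ (m k) T y`. -/
theorem map_mulVec_mem_contracted_of_isIntegral {A B : Matrix (Fin n) (Fin n) ℤ}
    {T M : Matrix (Fin n) (Fin n) ℚ} (hM : IsIntegral ℤ M) (hMA : Commute M (baseChange ℚ A))
    {m : ℕ} (h : baseChange ℚ B ^ m * T = T * (M * baseChange ℚ A)) {p : ℕ} [Fact p.Prime]
    {y : Fin n → ℚ_[p]} (hy : y ∈ contracted p A) :
    T.map (algebraMap ℚ ℚ_[p]) *ᵥ y ∈ contracted p B := by
  obtain ⟨c, hc, hcM⟩ := exists_norm_pow_le_of_isIntegral p hM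
  obtain ⟨d, hd, hdT⟩ := exists_norm_mulVec_le p (T.map (algebraMap ℚ ℚ_[p]))
  refine mem_contracted_of_exists p fun ε hε => ?_
  obtain ⟨k, hk⟩ := exists_norm_lt_of_mem_contracted p hy (ε := ε / (d * c)) (by positivity)
  refine ⟨m * k, ?_⟩
  have h1 : baseChange ℚ B ^ (m * k) * T = T * (M ^ k * baseChange ℚ A ^ k) := by
    rw [← hMA.mul_pow, pow_mul]
    have h2 : SemiconjBy T (M * baseChange ℚ A) (baseChange ℚ B ^ m) := h.symm
    exact (h2.pow_right k).eq.symm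
  have h3 := congrArg (fun X => X.map (algebraMap ℚ ℚ_[p])) h1
  simp only [Matrix.map_mul, Matrix.map_pow, map_baseChange] at h3
  rw [Matrix.mulVec_mulVec, h3, ← Matrix.mulVec_mulVec, ← Matrix.mulVec_mulVec]
  calc _ ≤ d * (c * ‖baseChange ℚ_[p] A ^ k *ᵥ y‖) :=
        (hdT _).trans (mul_le_mul_of_nonneg_left (hcM k _) hd.le)
    _ = (d * c) * ‖baseChange ℚ_[p] A ^ k *ᵥ y‖ := by ring
    _ < (d * c) * (ε / (d * c)) := mul_lt_mul_of_pos_left hk (by positivity)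
    _ = ε := by field_simp

end IntegralMatrix

/-! ### Eigenvalues and their prime divisors -/

section Eigenvectors

variable {n : ℕ} {K : Type*} [Field K]

theorem isEigenvector_iff {A : Matrix (Fin n) (Fin n) ℤ} {a : K} {u : Fin n → K} :
    IsEigenvector K A a u ↔ baseChange K A *ᵥ u = a • u ∧ u ≠ 0 := by
  rw [IsEigenvector, Module.End.hasEigenvector_iff, Module.End.mem_eigenspace_iff,
    Matrix.toLin'_apply]

theorem exists_isEigenvector_of_isRoot {A : Matrix (Fin n) (Fin n) ℤ} {a : K}
    (h : (baseChange K A).charpoly.IsRoot a) : ∃ u, IsEigenvector K A a u := by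
  have h1 : Module.End.HasEigenvalue (Matrix.toLin' (baseChange K A)) a := by
    rw [Module.End.hasEigenvalue_iff_isRoot_charpoly]
    rwa [Matrix.charpoly_toLin']
  exact h1.exists_hasEigenvector

theorem isIntegral_of_isEigenvector {A : Matrix (Fin n) (Fin n) ℤ} {a : K} {u : Fin n → K}
    (h : IsEigenvector K A a u) : IsIntegral ℤ a := by
  have h1 := (Module.End.hasEigenvalue_iff_isRoot_charpoly _ _).mp
    (Module.End.hasEigenvalue_of_hasEigenvector h)
  rw [Matrix.charpoly_toLin', Matrix.charpoly_map, Polynomial.IsRoot, Polynomial.eval_map] at h1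
  exact ⟨A.charpoly, Matrix.charpoly_monic A, h1⟩

theorem ne_zero_of_isEigenvector [CharZero K] {A : Matrix (Fin n) (Fin n) ℤ} (hA : A.det ≠ 0)
    {a : K} {u : Fin n → K} (h : IsEigenvector K A a u) : a ≠ 0 := by
  rintro rfl
  obtain ⟨h1, h2⟩ := isEigenvector_iff.mp h
  rw [zero_smul] at h1
  exact h2 (Matrix.eq_zero_of_mulVec_eq_zero (isUnit_det_baseChange K hA).ne_zero h1)

theorem irreducible_charpoly_baseChange {A : Matrix (Fin n) (Fin n) ℤ}
    (h : Irreducible A.charpoly) : Irreducible (baseChange ℚ A).charpoly := by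
  rw [Matrix.charpoly_map]
  exact (Polynomial.Monic.irreducible_iff_irreducible_map_fraction_map (K := ℚ)
    (Matrix.charpoly_monic A)).mp h

theorem pow_mulVec_of_mulVec_eq_smul {R : Type*} [CommRing R] {M : Matrix (Fin n) (Fin n) R}
    {a : R} {u : Fin n → R} (h : M *ᵥ u = a • u) (k : ℕ) : M ^ k *ᵥ u = a ^ k • u := by
  induction k with
  | zero => simp
  | succ k ih => rw [pow_succ, ← Matrix.mulVec_mulVec, h, Matrix.mulVec_smul, ih, smul_smul,
      pow_succ']

/-- By hypothesis `b` lies in every prime containing `a`, that is, in the radical of `(a)`; these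
primes are nonzero because `a ≠ 0`. -/
theorem exists_pow_eq_mul {a b : 𝓞 K} (ha : a ≠ 0)
    (h : ∀ 𝔭 : Ideal (𝓞 K), 𝔭.IsPrime → 𝔭 ≠ ⊥ → a ∈ 𝔭 → b ∈ 𝔭) :
    ∃ (m : ℕ) (c : 𝓞 K), b ^ m = a * c := by
  have hb : b ∈ (Ideal.span {a}).radical := by
    rw [Ideal.radical_eq_sInf, Ideal.mem_sInf]
    rintro 𝔭 ⟨h1, h2⟩
    have ha' : a ∈ 𝔭 := h1 (Ideal.mem_span_singleton_self a)
    exact h 𝔭 h2 (fun h0 => ha (by simpa [h0] using ha')) ha'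
  obtain ⟨m, hm⟩ := hb
  obtain ⟨c, hc⟩ := Ideal.mem_span_singleton.mp hm
  exact ⟨m, c, hc⟩

variable [NumberField K]

/-- If every prime divisor of the eigenvalue `a` of `A` divides the eigenvalue `b` of `B`, then an
isomorphism `T` that matches the eigenvectors maps the contracted part of `A` to that of `B`. -/
theorem map_mulVec_mem_contracted_of_isEigenvector {A B : Matrix (Fin n) (Fin n) ℤ}
    (hA : A.det ≠ 0) (hAirr : Irreducible A.charpoly) {a b : 𝓞 K} {u v : Fin n → K}
    (hu : IsEigenvector K A (a : K) u) (hv : IsEigenvector K B (b : K) v)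
    (h : ∀ 𝔭 : Ideal (𝓞 K), 𝔭.IsPrime → 𝔭 ≠ ⊥ → a ∈ 𝔭 → b ∈ 𝔭)
    {T S : Matrix (Fin n) (Fin n) ℚ} (hTS : T * S = 1)
    (hT : T.map (algebraMap ℚ K) *ᵥ u = v)
    {p : ℕ} [Fact p.Prime] {y : Fin n → ℚ_[p]} (hy : y ∈ contracted p A) :
    T.map (algebraMap ℚ ℚ_[p]) *ᵥ y ∈ contracted p B := by
  have hirr := irreducible_charpoly_baseChange hAirr
  obtain ⟨hu1, hu0⟩ := isEigenvector_iff.mp hu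
  obtain ⟨hv1, -⟩ := isEigenvector_iff.mp hv
  have haK : (a : K) ≠ 0 := ne_zero_of_isEigenvector hA hu
  have ha : a ≠ 0 := fun h0 => haK (by simp [h0])
  obtain ⟨m, c, hc⟩ := exists_pow_eq_mul ha h
  have hdet := isUnit_det_baseChange ℚ hA
  have hST : S * T = 1 := mul_eq_one_comm.mp hTS
  have hAu : (baseChange ℚ A).map (algebraMap ℚ K) *ᵥ u = (a : K) • u := by rwa [map_baseChange]
  have hSv : S.map (algebraMap ℚ K) *ᵥ v = u := by
    rw [← hT, Matrix.mulVec_mulVec, ← Matrix.map_mul, hST]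
    simp
  have hinv : (baseChange ℚ A)⁻¹.map (algebraMap ℚ K) *ᵥ u = (a : K)⁻¹ • u := by
    have h1 : (baseChange ℚ A)⁻¹.map (algebraMap ℚ K) *ᵥ ((a : K) • u) = u := by
      rw [← hAu, Matrix.mulVec_mulVec, ← Matrix.map_mul, Matrix.nonsing_inv_mul _ hdet]
      simp
    rw [Matrix.mulVec_smul] at h1
    rw [eq_inv_smul_iff₀ haK, h1]
  -- Chosen so that `u` is an eigenvector with eigenvalue `b ^ m / a = c`. Any rational matrix
  -- killing `u` is zero, so identities for `c` lift to `M`.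
  obtain ⟨M, hMdef⟩ : ∃ M, M = S * baseChange ℚ B ^ m * T * (baseChange ℚ A)⁻¹ := ⟨_, rfl⟩
  have hMu : M.map (algebraMap ℚ K) *ᵥ u = (c : K) • u := by
    have hcK : (b : K) ^ m = (a : K) * (c : K) := by exact_mod_cast congrArg (algebraMap (𝓞 K) K) hc
    simp only [hMdef, Matrix.map_mul, Matrix.map_pow, map_baseChange, ← Matrix.mulVec_mulVec]
    rw [hinv, Matrix.mulVec_smul, hT, Matrix.mulVec_smul, pow_mulVec_of_mulVec_eq_smul hv1,
      Matrix.mulVec_smul, Matrix.mulVec_smul, hSv, smul_smul, hcK, inv_mul_cancel_left₀ haK]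
  have hMA : Commute M (baseChange ℚ A) := by
    refine sub_eq_zero.mp (eq_zero_of_map_mulVec_eq_zero hirr hu0 hAu ?_)
    rw [Matrix.map_sub _ (map_sub _), Matrix.sub_mulVec, Matrix.map_mul, Matrix.map_mul,
      ← Matrix.mulVec_mulVec, ← Matrix.mulVec_mulVec, hAu, hMu, Matrix.mulVec_smul,
      Matrix.mulVec_smul, hAu, hMu, smul_comm, sub_self]
  have hM : IsIntegral ℤ M := by
    obtain ⟨q, hq, hq0⟩ := c.2
    refine ⟨q, hq, ?_⟩
    have h1 : Polynomial.aeval M (q.map (algebraMap ℤ ℚ)) = 0 := by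
      refine eq_zero_of_map_mulVec_eq_zero hirr hu0 hAu ?_
      rw [aeval_map_mulVec_of_eigenvector hMu, Polynomial.aeval_map_algebraMap]
      have : Polynomial.aeval (c : K) q = 0 := hq0
      rw [this, zero_smul]
    rwa [Polynomial.aeval_map_algebraMap] at h1
  refine map_mulVec_mem_contracted_of_isIntegral hM hMA (m := m) ?_ hy
  rw [hMdef, mul_assoc _ (baseChange ℚ A)⁻¹, Matrix.nonsing_inv_mul _ hdet, mul_one, mul_assoc S,
    ← mul_assoc T, hTS, one_mul]

theorem finrank_contracted_le {A B : Matrix (Fin n) (Fin n) ℤ}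
    {T S : Matrix (Fin n) (Fin n) ℚ} (hTS : T * S = 1) {p : ℕ} [Fact p.Prime]
    (h : ∀ y ∈ contracted p A, T.map (algebraMap ℚ ℚ_[p]) *ᵥ y ∈ contracted p B) :
    Module.finrank ℚ_[p] (contracted p A) ≤ Module.finrank ℚ_[p] (contracted p B) := by
  refine LinearMap.finrank_le_finrank_of_injective
    (f := (Matrix.toLin' (T.map (algebraMap ℚ ℚ_[p]))).restrict (q := contracted p B) h) ?_
  intro x y hxy
  apply Subtype.ext
  have h1 := congrArg Subtype.val hxy
  have h2 : T.map (algebraMap ℚ ℚ_[p]) *ᵥ (x : Fin n → ℚ_[p]) =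
    T.map (algebraMap ℚ ℚ_[p]) *ᵥ (y : Fin n → ℚ_[p]) := h1
  have h3 := congrArg (fun z => S.map (algebraMap ℚ ℚ_[p]) *ᵥ z) h2
  simpa [Matrix.mulVec_mulVec, ← Matrix.map_mul, mul_eq_one_comm.mp hTS] using h3

/-- If `T` maps `G_A` to `G_B`, and `T⁻¹` maps `G_B` to `G_A`, and the left eigenvectors `w`, `z`
of `A`, `B` correspond to each other, then every prime divisor of the eigenvalue of `B` divides the
eigenvalue of `A`. -/
theorem mem_prime_of_mem_prime {A B : Matrix (Fin n) (Fin n) ℤ} (hA : A.det ≠ 0) (hB : B.det ≠ 0)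
    {T S : Matrix (Fin n) (Fin n) ℚ} (hTS : T * S = 1) (hT : ∀ x ∈ G A, T *ᵥ x ∈ G B)
    (hS : ∀ x ∈ G B, S *ᵥ x ∈ G A) {a b : 𝓞 K} {w z : Fin n → K} (hw0 : w ≠ 0)
    (hw : w ᵥ* baseChange K A = (a : K) • w) (hz : z ᵥ* baseChange K B = (b : K) • z)
    (hzw : z ᵥ* T.map (algebraMap ℚ K) = w) {𝔭 : Ideal (𝓞 K)} (h𝔭 : 𝔭.IsPrime) (hb : b ∈ 𝔭) :
    a ∈ 𝔭 := by
  by_contra ha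
  obtain ⟨d, hd⟩ := IsLocalization.exist_integer_multiples_of_finite (nonZeroDivisors (𝓞 K)) w
  choose w' hw' using hd
  obtain ⟨j, hj⟩ : ∃ j, w j ≠ 0 := by
    by_contra! hh
    exact hw0 (funext hh)
  have hd0 : ((d : 𝓞 K) : K) ≠ 0 := by
    simp
  have hwd : ∀ i, ((w' i : 𝓞 K) : K) = ((d : 𝓞 K) : K) * w i := fun i => by
    exact (hw' i).trans (Algebra.smul_def _ _)
  have hpowA : ∀ (k : ℕ) (y : Fin n → K),
      w ⬝ᵥ (baseChange K A ^ k *ᵥ y) = (a : K) ^ k * (w ⬝ᵥ y) := by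
    intro k y
    have h1 : (baseChange K A)ᵀ *ᵥ w = (a : K) • w := by rwa [Matrix.mulVec_transpose]
    rw [Matrix.dotProduct_mulVec, ← Matrix.mulVec_transpose, Matrix.transpose_pow,
      pow_mulVec_of_mulVec_eq_smul h1, smul_dotProduct, smul_eq_mul]
  have hpowB : ∀ (k : ℕ) (y : Fin n → K),
      z ⬝ᵥ (baseChange K B ^ k *ᵥ y) = (b : K) ^ k * (z ⬝ᵥ y) := by
    intro k y
    have h1 : (baseChange K B)ᵀ *ᵥ z = (b : K) • z := by rwa [Matrix.mulVec_transpose]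
    rw [Matrix.dotProduct_mulVec, ← Matrix.mulVec_transpose, Matrix.transpose_pow,
      pow_mulVec_of_mulVec_eq_smul h1, smul_dotProduct, smul_eq_mul]
  have hcast : ∀ (M : Matrix (Fin n) (Fin n) ℚ) (y : Fin n → ℚ),
      M.map (algebraMap ℚ K) *ᵥ (fun i => algebraMap ℚ K (y i)) =
        fun i => algebraMap ℚ K ((M *ᵥ y) i) := fun M y =>
    funext fun i => (RingHom.map_mulVec (algebraMap ℚ K) M y i).symm
  have hcastA : ∀ (A : Matrix (Fin n) (Fin n) ℤ) (k : ℕ) (y : Fin n → ℚ),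
      baseChange K A ^ k *ᵥ (fun i => algebraMap ℚ K (y i)) =
        fun i => algebraMap ℚ K ((baseChange ℚ A ^ k *ᵥ y) i) := by
    intro A k y
    rw [← hcast, Matrix.map_pow, map_baseChange]
  -- Write `T e_j = B ^ m y'` and `y = S y'`. Pairing gives `w j = b ^ m ⟨w, y⟩`, while `A ^ k y` is
  -- integral; after clearing denominators `a ^ k w' j` is divisible by `b ^ m`, and `a ∉ 𝔭` can be
  -- cancelled.
  have hmem : ∀ m : ℕ, w' j ∈ 𝔭 ^ m := by
    intro m
    obtain ⟨y', hy', hBy⟩ := exists_pow_mulVec_eq hB (hT _ (single_mem_G hA j)) m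
    obtain ⟨k, x, hx⟩ := (mem_G_iff hA).mp (hS _ hy')
    set y := S *ᵥ y' with hy
    have hTy : T *ᵥ y = y' := by rw [hy, Matrix.mulVec_mulVec, hTS, Matrix.one_mulVec]
    have h1 : w j = (b : K) ^ m * (w ⬝ᵥ fun i => algebraMap ℚ K (y i)) := by
      have h2 : w j = w ⬝ᵥ (fun i => algebraMap ℚ K ((Pi.single j 1 : Fin n → ℚ) i)) := by
        rw [dotProduct, Finset.sum_eq_single j]
        · simp
        · intro i _ hi
          simp [hi]
        · simp
      rw [h2, ← hzw, ← Matrix.dotProduct_mulVec, ← Matrix.dotProduct_mulVec, hcast, hcast,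
        ← hBy, ← hcastA, hpowB, hTy]
    have h3 : (a : K) ^ k * (w ⬝ᵥ fun i => algebraMap ℚ K (y i)) = ∑ i, w i * (x i : K) := by
      rw [← hpowA, hcastA, hx]
      simp [dotProduct]
    have h4 : a ^ k * w' j = b ^ m * ∑ i, w' i * (x i : 𝓞 K) := by
      apply NumberField.RingOfIntegers.ext
      have h6 : ∀ i, ((x i : 𝓞 K) : K) = (x i : K) := fun i =>
        map_intCast (algebraMap (𝓞 K) K) _
      push_cast
      simp_rw [hwd, h6, mul_assoc]
      rw [← Finset.mul_sum, ← h3, h1]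
      ring
    have h5 : a ^ k * w' j ∈ 𝔭 ^ m := by
      rw [h4]
      exact Ideal.mul_mem_right _ _ (Ideal.pow_mem_pow hb m)
    exact (h𝔭.mul_mem_pow _ h5).resolve_left fun h6 => ha (h𝔭.mem_of_pow_mem _ h6)
  -- Krull's intersection theorem forces `w' j = 0`, although `w j ≠ 0`.
  have h7 : w' j ∈ (⨅ m : ℕ, 𝔭 ^ m) := by simpa [Ideal.mem_iInf] using hmem
  rw [Ideal.iInf_pow_eq_bot_of_isDomain 𝔭 h𝔭.ne_top, Ideal.mem_bot] at h7
  have h8 := hwd j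
  rw [h7] at h8
  exact mul_ne_zero hd0 hj (by simpa using h8.symm)

end Eigenvectors

/-! ### Entries and the ring `R A` -/

section Ring

variable {n : ℕ}

/-- If `A ^ k y` is integral, multiplying by the adjugate of `A ^ k` shows that `(det A) ^ k y` is
integral. -/
theorem apply_mem_R_of_mem_G {A : Matrix (Fin n) (Fin n) ℤ} (hA : A.det ≠ 0) {y : Fin n → ℚ}
    (hy : y ∈ G A) (i : Fin n) : y i ∈ R A := by
  obtain ⟨k, x, hx⟩ := (mem_G_iff hA).mp hy
  have hd : ((A.det : ℤ) : ℚ) ≠ 0 := by exact_mod_cast hA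
  have h1 : ((A.det : ℤ) : ℚ) ^ k • y =
      fun i => ((((A ^ k).adjugate *ᵥ x) i : ℤ) : ℚ) := by
    have h2 : (baseChange ℚ (A ^ k)).adjugate * baseChange ℚ A ^ k =
        ((A.det : ℤ) : ℚ) ^ k • 1 := by
      rw [← Matrix.map_pow, Matrix.adjugate_mul, det_baseChange, Matrix.det_pow, Int.cast_pow]
    have h3 : (baseChange ℚ (A ^ k)).adjugate = baseChange ℚ (A ^ k).adjugate :=
      (RingHom.map_adjugate (Int.castRingHom ℚ) (A ^ k)).symm
    calc ((A.det : ℤ) : ℚ) ^ k • y = (((A.det : ℤ) : ℚ) ^ k • (1 : Matrix _ _ ℚ)) *ᵥ y := by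
          rw [Matrix.smul_mulVec, Matrix.one_mulVec]
      _ = _ := by
          rw [← h2, ← Matrix.mulVec_mulVec, hx, h3]
          rw [← pow_one (baseChange ℚ _), baseChange_pow_mulVec, pow_one]
  have h4 : y i = (((A.det : ℤ) : ℚ)⁻¹) ^ k * ((((A ^ k).adjugate *ᵥ x) i : ℤ) : ℚ) := by
    rw [← congrFun h1 i, Pi.smul_apply, smul_eq_mul, inv_pow, inv_mul_cancel_left₀ (pow_ne_zero k hd)]
  rw [h4]
  exact mul_mem (pow_mem (Algebra.subset_adjoin (Set.mem_singleton _)) k) (intCast_mem _ _)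

theorem norm_le_one_of_mem_R {A : Matrix (Fin n) (Fin n) ℤ} {p : ℕ} [Fact p.Prime]
    (hp : ¬ (p : ℤ) ∣ A.det) {q : ℚ} (hq : q ∈ R A) : ‖(q : ℚ_[p])‖ ≤ 1 := by
  induction hq using Algebra.adjoin_induction with
  | mem x hx =>
    rw [Set.mem_singleton_iff.mp hx]
    have h3 : ‖((A.det : ℤ) : ℚ_[p])‖ = 1 := by
      refine le_antisymm (Padic.norm_int_le_one _) (not_lt.mp fun h => hp ?_)
      exact (PadicInt.norm_int_lt_one_iff_dvd _).mp (by simpa [PadicInt.norm_def] using h)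
    rw [Rat.cast_inv, Rat.cast_intCast, norm_inv, h3, inv_one]
  | algebraMap z => simpa using Padic.norm_int_le_one (p := p) z
  | add x y _ _ hx hy =>
    push_cast
    exact (IsUltrametricDist.norm_add_le_max _ _).trans (max_le hx hy)
  | mul x y _ _ hx hy =>
    push_cast
    rw [norm_mul]
    exact mul_le_one₀ hx (norm_nonneg _) hy

/-- `1 / det B` is the determinant of `Y = T⁻¹B⁻¹T`, whose columns `T⁻¹B⁻¹T e_j` lie in `G A` and so
have entries in `R A`. -/
theorem R_le_R {A B : Matrix (Fin n) (Fin n) ℤ} (hA : A.det ≠ 0) (hB : B.det ≠ 0)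
    {T S : Matrix (Fin n) (Fin n) ℚ} (hTS : T * S = 1) (hT : ∀ x ∈ G A, T *ᵥ x ∈ G B)
    (hS : ∀ x ∈ G B, S *ᵥ x ∈ G A) : R B ≤ R A := by
  rw [R, Algebra.adjoin_le_iff, Set.singleton_subset_iff, SetLike.mem_coe]
  choose y' hy' hBy using fun j => exists_pow_mulVec_eq hB (hT _ (single_mem_G hA j)) 1
  let Y : Matrix (Fin n) (Fin n) ℚ := Matrix.of fun i j => (S *ᵥ y' j) i
  have hY : ∀ i j, Y i j ∈ R A := fun i j => apply_mem_R_of_mem_G hA (hS _ (hy' j)) i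
  have h1 : baseChange ℚ B * T * Y = T := by
    refine Matrix.ext_of_mulVec_single fun j => ?_
    rw [← Matrix.mulVec_mulVec]
    have h2 : Y *ᵥ Pi.single j 1 = S *ᵥ y' j := by
      rw [Matrix.mulVec_single_one]; rfl
    rw [h2, ← hBy j, pow_one, ← Matrix.mulVec_mulVec, Matrix.mulVec_mulVec _ T, hTS,
      Matrix.one_mulVec]
  have hTdet : T.det ≠ 0 := fun h0 => by
    have := congrArg Matrix.det hTS
    simp [h0] at this
  have h3 := congrArg Matrix.det h1
  rw [Matrix.det_mul, Matrix.det_mul, det_baseChange, mul_right_comm] at h3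
  have h4 : ((B.det : ℤ) : ℚ) * Y.det = 1 := mul_right_cancel₀ hTdet (by rw [h3, one_mul])
  have h5 : ((B.det : ℤ) : ℚ)⁻¹ = Y.det := inv_eq_of_mul_eq_one_right h4
  rw [h5, Matrix.det_apply]
  refine sum_mem fun σ _ => ?_
  rw [Units.smul_def]
  exact zsmul_mem (prod_mem fun i _ => hY _ _) _

end Ring

/-! ### Assembling both directions -/

variable {n : ℕ}

/-- The inclusion is checked at each `p`. If `p` does not divide `det A`, the local group of `A` is
`ℤ_pⁿ` and `T` is integral. If the characteristic polynomial is `xⁿ` modulo `p`, every vector is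
contracted. Otherwise the `x_i` are contracted and the condition handles the `e_k`. -/
theorem mulVec_mem_G_of_satisfiesCondition {A B : Matrix (Fin n) (Fin n) ℤ} (hA : A.det ≠ 0)
    (hB : B.det ≠ 0) {α β : ∀ (p : ℕ) [Fact p.Prime], Fin n → Fin n → ℤ_[p]}
    (hα : IsCharacteristic A α) (hβ : IsCharacteristic B β) {T : Matrix (Fin n) (Fin n) ℚ}
    (hcontr : ∀ (p : ℕ) [Fact p.Prime], ∀ y ∈ contracted p A,
      T.map (algebraMap ℚ ℚ_[p]) *ᵥ y ∈ contracted p B)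
    (ht : ∀ (p : ℕ) [Fact p.Prime], t p A = t p B)
    (hint : ∀ (p : ℕ) [Fact p.Prime], ¬ (p : ℤ) ∣ A.det → ∀ i j, ‖(T i j : ℚ_[p])‖ ≤ 1)
    (hcond : ∀ (p : ℕ) [Fact p.Prime], p ∈ P' B → SatisfiesCondition B p (β p) T) :
    ∀ x ∈ G A, T *ᵥ x ∈ G B := by
  intro x hx
  refine mem_G_of_forall_mem_Gbar hB fun p _ => ?_
  rw [← map_mulVec_padicVec]
  have hxp : padicVec p x ∈ Gbar p A := Submodule.subset_span ⟨x, hx, rfl⟩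
  generalize padicVec p x = y at hxp
  by_cases hd : (p : ℤ) ∣ A.det
  · by_cases hX : A.charpoly.map (Int.castRingHom (ZMod p)) = Polynomial.X ^ n
    · exact contracted_le_Gbar p hB (hcontr p y (by rw [contracted_eq_top hX]; trivial))
    · have hpA : p ∈ P' A := ⟨Fact.out, hd, hX⟩
      have hpB : p ∈ P' B := by
        rw [mem_P'_iff] at hpA ⊢
        rwa [← ht]
      have hTe := (satisfiesCondition_iff hβ hpB).mp (hcond p hpB)
      have hdef := (mem_Gbar_iff_defect hα hpA).mp hxp
      rw [eq_sum_xVec_add_sum_single (t p A) (α p) y, Matrix.mulVec_add]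
      refine add_mem (contracted_le_Gbar p hB (hcontr p _ ?_)) ?_
      · refine Submodule.sum_mem _ fun i hi => Submodule.smul_mem _ _ ?_
        exact (mem_contracted_iff_defect hA hα hpA).mpr fun k hk =>
          defect_xVec _ (by simpa using hi) hk
      · rw [Matrix.mulVec_sum]
        refine Submodule.sum_mem _ fun k hk => ?_
        have hk' : t p A ≤ (k : ℕ) := by simpa using hk
        let d : ℤ_[p] := ⟨_, hdef k hk'⟩
        rw [Matrix.mulVec_smul]
        exact Submodule.smul_mem _ d (hTe k (ht p ▸ hk'))
  · obtain ⟨k, hk⟩ := (mem_Gbar_iff p hA).mp hxp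
    rw [norm_pow_mulVec_eq_of_not_dvd hd] at hk
    refine mem_Gbar_of_norm_le_one p hB ?_
    refine (norm_mulVec_le zero_le_one (fun i j => ?_) y).trans (by simpa using hk)
    simpa using hint p hd i j

theorem satisfiesCondition_of_mulVec_mem_G {A B : Matrix (Fin n) (Fin n) ℤ} (hA : A.det ≠ 0)
    {β : ∀ (p : ℕ) [Fact p.Prime], Fin n → Fin n → ℤ_[p]}
    (hβ : IsCharacteristic B β) {T : Matrix (Fin n) (Fin n) ℚ} (hT : ∀ x ∈ G A, T *ᵥ x ∈ G B)
    (p : ℕ) [Fact p.Prime] (hp : p ∈ P' B) : SatisfiesCondition B p (β p) T := by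
  refine (satisfiesCondition_iff hβ hp).mpr fun j _ => map_mulVec_mem_Gbar hT ?_
  refine mem_Gbar_of_norm_le_one p hA ?_
  rw [pi_norm_le_iff_of_nonneg zero_le_one]
  intro i
  rw [Pi.single_apply]
  split_ifs <;> simp

/-- An isomorphism from `G_A` to `G_B` conjugates `B` to a polynomial in `A`. -/
theorem exists_conj_eq_aeval (hn : 0 < n) {A B : Matrix (Fin n) (Fin n) ℤ}
    (hA : A.det ≠ 0) (hB : B.det ≠ 0) (hAirr : Irreducible A.charpoly)
    {α : ∀ (p : ℕ) [Fact p.Prime], Fin n → Fin n → ℤ_[p]} (hα : IsCharacteristic A α)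
    (hp : ∃ p : ℕ, p.Prime ∧ Nat.gcd (t p A) n = 1) {T S : Matrix (Fin n) (Fin n) ℚ}
    (hT : ∀ x ∈ G A, T *ᵥ x ∈ G B) (hS : ∀ x ∈ G B, S *ᵥ x ∈ G A) :
    ∃ f : Polynomial ℚ, S * baseChange ℚ B * T = Polynomial.aeval (baseChange ℚ A) f := by
  obtain ⟨p, hp, hgcd⟩ := hp
  have : Fact p.Prime := ⟨hp⟩
  have hirr := irreducible_charpoly_baseChange hAirr
  refine exists_eq_aeval_of_commute hirr hn
    (commute_of_coprime_finrank hirr hn (contracted p A) ?_ ?_ ?_)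
  · intro x hx
    rw [map_baseChange]
    exact mulVec_mem_contracted hA hx
  · intro x hx
    rw [Matrix.map_mul, Matrix.map_mul, map_baseChange, ← Matrix.mulVec_mulVec,
      ← Matrix.mulVec_mulVec]
    exact map_mulVec_mem_contracted hB hA hS
      (mulVec_mem_contracted hB (map_mulVec_mem_contracted hA hB hT hx))
  · rwa [finrank_contracted hA hα]

theorem image_mulVec_eq_iff {A B : Matrix (Fin n) (Fin n) ℤ} {T S : Matrix (Fin n) (Fin n) ℚ}
    (hTS : T * S = 1) :
    (fun x : Fin n → ℚ => T *ᵥ x) '' (G A : Set _) = (G B : Set _) ↔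
      (∀ x ∈ G A, T *ᵥ x ∈ G B) ∧ ∀ x ∈ G B, S *ᵥ x ∈ G A := by
  constructor
  · intro h
    refine ⟨fun x hx => h.le ⟨x, hx, rfl⟩, fun x hx => ?_⟩
    obtain ⟨y, hy, rfl⟩ := h.ge hx
    simpa [Matrix.mulVec_mulVec, mul_eq_one_comm.mp hTS] using hy
  · rintro ⟨h1, h2⟩
    refine Set.Subset.antisymm (Set.image_subset_iff.mpr h1) fun x hx => ⟨S *ᵥ x, h2 x hx, ?_⟩
    simp [Matrix.mulVec_mulVec, hTS]

end Solenoid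

end

theorem proposition5p9 {n : ℕ} (hn : 2 ≤ n) (A B : Matrix (Fin n) (Fin n) ℤ)
    (hA : A.det ≠ 0) (hB : B.det ≠ 0)
    (hAirr : Irreducible A.charpoly) (hBirr : Irreducible B.charpoly)
    (α β : ∀ (p : ℕ) [Fact p.Prime], Fin n → Fin n → ℤ_[p])
    (hα : Solenoid.IsCharacteristic A α) (hβ : Solenoid.IsCharacteristic B β)
    (hp : ∃ p : ℕ, p.Prime ∧ Nat.gcd (Solenoid.t p A) n = 1)
    (K : Type*) [Field K] [NumberField K]
    (hKA : (Solenoid.baseChange K A).charpoly.Splits)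
    (hKB : (Solenoid.baseChange K B).charpoly.Splits)
    (T : GL (Fin n) ℚ) :
    (fun x : Fin n → ℚ => (T : Matrix (Fin n) (Fin n) ℚ) *ᵥ x) '' (Solenoid.G A : Set _) =
        (Solenoid.G B : Set _) ↔
      ∃ (a b : 𝓞 K) (u v : Fin n → K),
        Solenoid.IsEigenvector K A (a : K) u ∧
        Solenoid.IsEigenvector K B (b : K) v ∧
        Solenoid.SamePrimeDivisors a b ∧
        Solenoid.MemGL (Solenoid.R A) T ∧
        (T : Matrix (Fin n) (Fin n) ℚ).map (algebraMap ℚ K) *ᵥ u = v ∧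
        (∀ (p : ℕ) [Fact p.Prime], p ∈ Solenoid.P' B →
          Solenoid.SatisfiesCondition B p (β p) (T : Matrix (Fin n) (Fin n) ℚ)) ∧
        (∀ (p : ℕ) [Fact p.Prime], p ∈ Solenoid.P' A →
          Solenoid.SatisfiesCondition A p (α p)
            ((T⁻¹ : GL (Fin n) ℚ) : Matrix (Fin n) (Fin n) ℚ)) := by
  open Solenoid in
  have hTS : (T : Matrix (Fin n) (Fin n) ℚ) * ((T⁻¹ : GL (Fin n) ℚ) : Matrix _ _ ℚ) = 1 :=
    T.mul_inv
  unfold MemGL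
  generalize ((T⁻¹ : GL (Fin n) ℚ) : Matrix (Fin n) (Fin n) ℚ) = S at *
  generalize (T : Matrix (Fin n) (Fin n) ℚ) = T at *
  have hST : S * T = 1 := mul_eq_one_comm.mp hTS
  rw [image_mulVec_eq_iff hTS]
  have hmap : ∀ {X Y : Matrix (Fin n) (Fin n) ℚ}, X * Y = 1 →
      X.map (algebraMap ℚ K) * Y.map (algebraMap ℚ K) = 1 := by
    intro X Y h
    rw [← Matrix.map_mul, h]
    simp
  constructor
  · rintro ⟨hT, hS⟩
    obtain ⟨f, hf⟩ := exists_conj_eq_aeval (by omega) hA hB hAirr hα hp hT hS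
    obtain ⟨a, ha⟩ := hKA.exists_eval_eq_zero (by
      rw [Matrix.charpoly_degree_eq_dim, Fintype.card_fin]
      exact_mod_cast (by omega : n ≠ 0))
    obtain ⟨u, hu⟩ := exists_isEigenvector_of_isRoot ha
    -- A left eigenvector for the same root `a`. Since `C = f(A)`, both `u` and `w` are eigenvectors
    -- of `C` for `b = f(a)`, so `T u` and `w T⁻¹` are right and left eigenvectors of `B` for `b`.
    obtain ⟨w, hw⟩ := exists_isEigenvector_of_isRoot (A := Aᵀ) (K := K) (a := a) (by
      rw [baseChange, Matrix.transpose_map, Matrix.charpoly_transpose]; exact ha)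
    obtain ⟨hu1, hu0⟩ := isEigenvector_iff.mp hu
    obtain ⟨hw1, hw0⟩ := isEigenvector_iff.mp hw
    rw [baseChange, Matrix.transpose_map] at hw1
    set b := Polynomial.aeval a f with hb
    have hCu := aeval_map_mulVec_of_eigenvector (A := baseChange ℚ A) (a := a) (u := u)
      (by rwa [map_baseChange]) f
    have hCw := aeval_map_mulVec_of_eigenvector (A := (baseChange ℚ A)ᵀ) (a := a) (u := w)
      (by rwa [Matrix.transpose_map, map_baseChange]) f
    rw [← hf, ← hb] at hCu
    rw [← transpose_aeval, ← hf, ← hb, Matrix.transpose_map] at hCw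
    simp only [Matrix.map_mul, map_baseChange] at hCu hCw
    set TK := T.map (algebraMap ℚ K) with hTK
    set SK := S.map (algebraMap ℚ K) with hSK
    have hTSK : TK * SK = 1 := hmap hTS
    have hSTK : SK * TK = 1 := hmap hST
    have hv1 : baseChange K B *ᵥ (TK *ᵥ u) = b • (TK *ᵥ u) := by
      have h1 := congrArg (fun z => TK *ᵥ z) hCu
      simpa only [Matrix.mulVec_smul, Matrix.mulVec_mulVec, ← mul_assoc, hTSK, one_mul] using h1
    have hv0 : TK *ᵥ u ≠ 0 := by
      intro h0
      have h1 := congrArg (fun z => SK *ᵥ z) h0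
      exact hu0 (by simpa [Matrix.mulVec_mulVec, hSTK] using h1)
    have hv : IsEigenvector K B b (TK *ᵥ u) := isEigenvector_iff.mpr ⟨hv1, hv0⟩
    rw [Matrix.mulVec_transpose] at hw1 hCw
    have hz1 : (w ᵥ* SK) ᵥ* baseChange K B = b • (w ᵥ* SK) := by
      have h1 := congrArg (fun z => z ᵥ* SK) hCw
      simpa only [Matrix.smul_vecMul, Matrix.vecMul_vecMul, mul_assoc, hTSK, mul_one] using h1
    have hz0 : w ᵥ* SK ≠ 0 := by
      intro h0
      have h1 := congrArg (fun z => z ᵥ* TK) h0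
      exact hw0 (by simpa [Matrix.vecMul_vecMul, hSTK] using h1)
    have hzw : (w ᵥ* SK) ᵥ* TK = w := by
      rw [Matrix.vecMul_vecMul, hSTK, Matrix.vecMul_one]
    let a' : 𝓞 K := ⟨a, isIntegral_of_isEigenvector hu⟩
    let b' : 𝓞 K := ⟨b, isIntegral_of_isEigenvector hv⟩
    refine ⟨a', b', u, TK *ᵥ u, hu, hv, ?_, ?_, rfl, ?_, ?_⟩
    · intro 𝔭 h𝔭 _
      refine Ideal.dvd_span_singleton.trans (Iff.trans ?_ Ideal.dvd_span_singleton.symm)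
      exact ⟨fun h => mem_prime_of_mem_prime (a := b') (b := a') hB hA hST hS hT hz0 hz1 hw1 rfl
        h𝔭 h,
        fun h => mem_prime_of_mem_prime (a := a') (b := b') hA hB hTS hT hS hw0 hw1 hz1 hzw h𝔭 h⟩
    · intro i j
      -- The columns of `T` lie in `G B`, so its entries are a priori only in `R B`.
      have hR := R_le_R hA hB hTS hT hS
      constructor
      · apply hR
        simpa using apply_mem_R_of_mem_G hB (hT _ (single_mem_G hA j)) i
      · simpa using apply_mem_R_of_mem_G hA (hS _ (single_mem_G hB j)) i
    · exact fun p _ hpB => satisfiesCondition_of_mulVec_mem_G hA hβ hT p hpB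
    · exact fun p _ hpA => satisfiesCondition_of_mulVec_mem_G hB hα hS p hpA
  · rintro ⟨a, b, u, v, hu, hv, hab, hGL, hTu, hcB, hcA⟩
    simp only [SamePrimeDivisors, Ideal.dvd_span_singleton] at hab
    have hSv : S.map (algebraMap ℚ K) *ᵥ v = u := by
      rw [← hTu, Matrix.mulVec_mulVec, hmap hST, Matrix.one_mulVec]
    have hcT : ∀ (p : ℕ) [Fact p.Prime], ∀ y ∈ contracted p A,
        T.map (algebraMap ℚ ℚ_[p]) *ᵥ y ∈ contracted p B := fun p _ y hy =>
      map_mulVec_mem_contracted_of_isEigenvector hA hAirr hu hv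
        (fun 𝔭 h1 h2 => (hab 𝔭 h1 h2).mp) hTS hTu hy
    have hcS : ∀ (p : ℕ) [Fact p.Prime], ∀ y ∈ contracted p B,
        S.map (algebraMap ℚ ℚ_[p]) *ᵥ y ∈ contracted p A := fun p _ y hy =>
      map_mulVec_mem_contracted_of_isEigenvector hB hBirr hv hu
        (fun 𝔭 h1 h2 => (hab 𝔭 h1 h2).mpr) hST hSv hy
    have ht : ∀ (p : ℕ) [Fact p.Prime], t p A = t p B := fun p _ => by
      rw [← finrank_contracted hA hα, ← finrank_contracted hB hβ]
      exact le_antisymm (finrank_contracted_le hTS (hcT p)) (finrank_contracted_le hST (hcS p))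
    refine ⟨mulVec_mem_G_of_satisfiesCondition hA hB hα hβ hcT ht
        (fun p _ hd i j => norm_le_one_of_mem_R hd (hGL i j).1) hcB,
      mulVec_mem_G_of_satisfiesCondition hB hA hβ hα hcS (fun p _ => (ht p).symm)
        (fun p _ hd i j => norm_le_one_of_mem_R (A := A) ?_ (hGL i j).2) hcA⟩
    -- The entries of `T⁻¹` lie in `R A`, but integrality is needed away from `det B`; equal
    -- multiplicities show that both determinants have the same prime divisors.
    rwa [← t_pos_iff, ht p, t_pos_iff]
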